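/- Let $\mathcal H_1,\mathcal H_2$ be complex separable Hilbert spaces, possibly infinite-dimensional, and let $\rho$ be a density operator on $\mathcal H_1\otimes\mathcal H_2$. Suppose that $\rho$ has a tensor-positive source operator $R$ on $\mathcal H_1\otimes\mathcal H_2\otimes\mathcal H_2$, that is, a self-adjoint trace class operator $R\neq 0$ with $$\mathrm{tr}^{(2)}_{\mathcal H_2}[R]=\mathrm{tr}^{(3)}_{\mathcal H_2}[R]=\rho ,\qquad (\psi_1\otimes\psi_2\otimes\psi_3,\;R\,\psi_1\otimes\psi_2\otimes\psi_3)\ge 0\quad\text{for all }\psi_1\in\mathcal H_1,\ \psi_2,\psi_3\in\mathcal H_2 ,$$ where $\mathrm{tr}^{(k)}$ is the partial trace over the $k$-th factor. Put $\sigma_R:=\mathrm{tr}^{(1)}_{\mathcal H_1}[R]$, an operator on $\mathcal H_2\otimes\mathcal H_2$. Let $\Lambda\subseteq[-1,1]$ be a Borel set, let $M_1^{(a_i)}$ and $M_2^{(b_k)}$, $i,k=1,2$, be normalized positive operator-valued measures on $\Lambda$ with values in the bounded operators on $\mathcal H_1$ and $\mathcal H_2$, respectively, let $$P^{(a_i,b_k)}(d\lambda_1\times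 d\lambda_2)=\mathrm{tr}\big[\rho\,\{M_1^{(a_i)}(d\lambda_1)\otimes M_2^{(b_k)}(d\lambda_2)\}\big],\qquad A_i=\int\lambda\,M_1^{(a_i)}(d\lambda),\quad B_k=\int\lambda\,M_2^{(b_k)}(d\lambda),$$ and let $\langle\lambda_1\lambda_2\rangle^{(a_i,b_k)}=\int\lambda_1\lambda_2\,P^{(a_i,b_k)}(d\lambda_1\times d\lambda_2)=\mathrm{tr}[\rho(A_i\otimes B_k)]$. (1) The four joint distributions admit a local hidden variable (LHV) model: there are a probability space $(\Omega,\nu)$ and conditional probability distributions $P_1^{(a_i)}(\cdot|\omega)$, $P_2^{(b_k)}(\cdot|\omega)$ on $\Lambda$ such that $$P^{(a_i,b_k)}(d\lambda_1\times d\lambda_2)=\int_\Omega P_1^{(a_i)}(d\lambda_1|\omega)\,P_2^{(b_k)}(d\lambda_2|\omega)\,\nu(d\omega),\qquad i,k=1,2 .$$ (2) If, in addition, for one choice of the sign, $$\mathrm{tr}[\sigma_R(B_1\otimes B_2)]\mp\mathrm{tr}[\rho(A_2\otimes B_2)]\ge 0 ,$$ then, with the same choice of the sign, there is an LHV model as in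 (1) that satisfies the condition $$\int\lambda_2'(\lambda_2\mp\lambda_1')\,\mu(d\lambda_1'\times d\lambda_2\times d\lambda_2')\ge 0,\qquad \mu(d\lambda_1'\times d\lambda_2\times d\lambda_2')=\int_\Omega P_1^{(a_2)}(d\lambda_1'|\omega)P_2^{(b_1)}(d\lambda_2|\omega)P_2^{(b_2)}(d\lambda_2'|\omega)\,\nu(d\omega),$$ and the original Bell inequality $$\big|\langle\lambda_1\lambda_2\rangle^{(a_1,b_1)}-\langle\lambda_1\lambda_2\rangle^{(a_1,b_2)}\big|\le 1\mp\langle\lambda_1\lambda_2\rangle^{(a_2,b_2)}$$ holds, that is, $$\big|\mathrm{tr}[\rho(A_1\otimes B_1)]-\mathrm{tr}[\rho(A_1\otimes B_2)]\big|\le 1\mp\mathrm{tr}[\rho(A_2\otimes B_2)] .$$ -/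

import Mathlib

open MeasureTheory ProbabilityTheory
open scoped TensorProduct InnerProductSpace

noncomputable section

namespace QuantumBell

/-! ### Hilbert-space tensor products -/

section Tensor

variable {E F G K : Type*}
  [NormedAddCommGroup E] [InnerProductSpace ℂ E] [NormedAddCommGroup F] [InnerProductSpace ℂ F]
  [NormedAddCommGroup G] [InnerProductSpace ℂ G] [NormedAddCommGroup K] [InnerProductSpace ℂ K]

/-- The Hilbert-space tensor product: the completion of the algebraic tensor product with the
inner product `⟪x ⊗ y, x' ⊗ y'⟫ = ⟪x, x'⟫ * ⟪y, y'⟫`. -/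
abbrev HTensor (E F : Type*) [NormedAddCommGroup E] [InnerProductSpace ℂ E]
    [NormedAddCommGroup F] [InnerProductSpace ℂ F] : Type _ :=
  UniformSpace.Completion (E ⊗[ℂ] F)

/-- The product vector `x ⊗ y`. -/
def htmul (x : E) (y : F) : HTensor E F := ((x ⊗ₜ[ℂ] y : E ⊗[ℂ] F) : HTensor E F)

/-- The bounded operator `A ⊗ B` with `(A ⊗ B) (x ⊗ y) = A x ⊗ B y`. -/
def opTensor (A : E →L[ℂ] F) (B : G →L[ℂ] K) : HTensor E G →L[ℂ] HTensor F K :=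
  (TensorProduct.mapL A B).completion

/-- The operator `y ↦ e ⊗ y`. -/
def insertLeft (F : Type*) [NormedAddCommGroup F] [InnerProductSpace ℂ F] (e : E) :
    F →L[ℂ] HTensor E F :=
  UniformSpace.Completion.toComplL ∘L TensorProduct.mkL ℂ E F e

/-- The operator `x ↦ x ⊗ e`. -/
def insertRight (E : Type*) [NormedAddCommGroup E] [InnerProductSpace ℂ E] (e : F) :
    E →L[ℂ] HTensor E F :=
  UniformSpace.Completion.toComplL ∘L (TensorProduct.mkL ℂ E F).flip e

theorem opTensor_htmul (A : E →L[ℂ] F) (B : G →L[ℂ] K) (x : E) (y : G) :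
    opTensor A B (htmul x y) = htmul (A x) (B y) := by
  simp [opTensor, htmul]

theorem insertLeft_apply (e : E) (y : F) : insertLeft F e y = htmul e y := rfl

theorem insertRight_apply (e : F) (x : E) : insertRight E e x = htmul x e := rfl

end Tensor

/-! ### Trace, trace class, density operators -/

section Trace

variable {H K : Type*} [NormedAddCommGroup H] [InnerProductSpace ℂ H] [CompleteSpace H]
  [NormedAddCommGroup K] [InnerProductSpace ℂ K] [CompleteSpace K]

/-- The index set of a fixed orthonormal basis of a Hilbert space. -/
def basisIndex (H : Type*) [NormedAddCommGroup H] [InnerProductSpace ℂ H] [CompleteSpace H] :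
    Set H :=
  (exists_hilbertBasis ℂ H).choose

/-- A fixed orthonormal basis of a Hilbert space. -/
def basis (H : Type*) [NormedAddCommGroup H] [InnerProductSpace ℂ H] [CompleteSpace H] :
    HilbertBasis (basisIndex H) ℂ H :=
  (exists_hilbertBasis ℂ H).choose_spec.choose

/-- `T` is of trace class: `tr |T| < ∞`, where `|T|` is the positive square root of `T† T`. -/
def IsTraceClass (T : H →L[ℂ] H) : Prop :=
  Summable fun i => (⟪basis H i, CFC.abs T (basis H i)⟫_ℂ).re

/-- The trace (for trace class operators it does not depend on the orthonormal basis). -/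
def trace (T : H →L[ℂ] H) : ℂ := ∑' i, ⟪basis H i, T (basis H i)⟫_ℂ

/-- Density operators: positive trace class operators of unit trace. -/
structure IsDensityOperator (ρ : H →L[ℂ] H) : Prop where
  isPositive : ρ.IsPositive
  isTraceClass : IsTraceClass ρ
  trace_eq_one : trace ρ = 1

/-- The partial trace `∑ i, (V eᵢ)† T (V eᵢ)` over the factor `E`, where `(eᵢ)` is an orthonormal
basis of `E` and `V e` inserts the vector `e` at the place of that factor. For a trace class
operator `T` the series converges absolutely in the operator norm, and its sum does not depend on
the basis. -/
def partialTrace {E : Type*} [NormedAddCommGroup E] [InnerProductSpace ℂ E] [CompleteSpace E]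
    (V : E → (H →L[ℂ] K)) (T : K →L[ℂ] K) : H →L[ℂ] H :=
  ∑' i, (ContinuousLinearMap.adjoint (V (basis E i))) ∘L T ∘L V (basis E i)

end Trace

/-! ### Source operators -/

section Source

variable {H₁ H₂ : Type*} [NormedAddCommGroup H₁] [InnerProductSpace ℂ H₁] [CompleteSpace H₁]
  [NormedAddCommGroup H₂] [InnerProductSpace ℂ H₂] [CompleteSpace H₂]

/-- The partial trace over the first factor of `H₁ ⊗ H₂ ⊗ H₂`. -/
def partialTrace₁ (T : HTensor H₁ (HTensor H₂ H₂) →L[ℂ] HTensor H₁ (HTensor H₂ H₂)) :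
    HTensor H₂ H₂ →L[ℂ] HTensor H₂ H₂ :=
  partialTrace (fun e : H₁ => insertLeft (HTensor H₂ H₂) e) T

/-- The partial trace over the second factor of `H₁ ⊗ H₂ ⊗ H₂`;
the inserted vectors are `x ⊗ y ↦ x ⊗ e ⊗ y`. -/
def partialTrace₂ (T : HTensor H₁ (HTensor H₂ H₂) →L[ℂ] HTensor H₁ (HTensor H₂ H₂)) :
    HTensor H₁ H₂ →L[ℂ] HTensor H₁ H₂ :=
  partialTrace (fun e : H₂ => opTensor (ContinuousLinearMap.id ℂ H₁) (insertLeft H₂ e)) T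

/-- The partial trace over the third factor of `H₁ ⊗ H₂ ⊗ H₂`;
the inserted vectors are `x ⊗ y ↦ x ⊗ y ⊗ e`. -/
def partialTrace₃ (T : HTensor H₁ (HTensor H₂ H₂) →L[ℂ] HTensor H₁ (HTensor H₂ H₂)) :
    HTensor H₁ H₂ →L[ℂ] HTensor H₁ H₂ :=
  partialTrace (fun e : H₂ => opTensor (ContinuousLinearMap.id ℂ H₁) (insertRight H₂ e)) T

/-- A source operator for `ρ` on `H₁ ⊗ H₂ ⊗ H₂`: a self-adjoint trace class operator, not
necessarily positive, whose partial traces over both copies of `H₂` are `ρ`. -/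
structure IsSourceOperator (R : HTensor H₁ (HTensor H₂ H₂) →L[ℂ] HTensor H₁ (HTensor H₂ H₂))
    (ρ : HTensor H₁ H₂ →L[ℂ] HTensor H₁ H₂) : Prop where
  isSelfAdjoint : IsSelfAdjoint R
  isTraceClass : IsTraceClass R
  partialTrace₂_eq : partialTrace₂ R = ρ
  partialTrace₃_eq : partialTrace₃ R = ρ

/-- Tensor positivity: `Z ≠ 0` and `⟪ψ₁ ⊗ ψ₂ ⊗ ψ₃, Z (ψ₁ ⊗ ψ₂ ⊗ ψ₃)⟫` is real and nonnegative for
all vectors `ψ₁, ψ₂, ψ₃`. -/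
def IsTensorPositive (Z : HTensor H₁ (HTensor H₂ H₂) →L[ℂ] HTensor H₁ (HTensor H₂ H₂)) : Prop :=
  Z ≠ 0 ∧ ∀ (ψ₁ : H₁) (ψ₂ ψ₃ : H₂),
    0 ≤ (⟪htmul ψ₁ (htmul ψ₂ ψ₃), Z (htmul ψ₁ (htmul ψ₂ ψ₃))⟫_ℂ).re ∧
      (⟪htmul ψ₁ (htmul ψ₂ ψ₃), Z (htmul ψ₁ (htmul ψ₂ ψ₃))⟫_ℂ).im = 0

end Source

/-! ### POV measures and their averages -/

section POVM

/-- A normalized positive operator-valued measure on a measurable space `X`. Only the values on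
measurable sets are meaningful. -/
structure POVM (X : Type*) [MeasurableSpace X] (H : Type*) [NormedAddCommGroup H]
    [InnerProductSpace ℂ H] [CompleteSpace H] where
  effect : Set X → (H →L[ℂ] H)
  isPositive : ∀ D, MeasurableSet D → (effect D).IsPositive
  effect_univ : effect Set.univ = 1
  hasSum_iUnion : ∀ D : ℕ → Set X, (∀ n, MeasurableSet (D n)) → Pairwise (Function.onFun Disjoint D) →
    ∀ φ ψ : H, HasSum (fun n => ⟪φ, effect (D n) ψ⟫_ℂ) ⟪φ, effect (⋃ n, D n) ψ⟫_ℂ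

namespace POVM

variable {X : Type*} [MeasurableSpace X] {H : Type*} [NormedAddCommGroup H]
  [InnerProductSpace ℂ H] [CompleteSpace H]

theorem effect_empty (M : POVM X H) : M.effect ∅ = 0 := by
  ext ψ
  refine ext_inner_left ℂ fun φ => ?_
  have h := (M.hasSum_iUnion (fun _ => ∅) (fun _ => MeasurableSet.empty)
    (fun _ _ _ => by simp [Function.onFun]) φ ψ).summable
  simpa using (summable_const_iff _).1 h

/-- The finite measure `D ↦ ⟪ψ, M(D) ψ⟫`. -/
def measure (M : POVM X H) (ψ : H) : Measure X :=
  Measure.ofMeasurable (fun D _ => ENNReal.ofReal (⟪ψ, M.effect D ψ⟫_ℂ).re)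
    (by simp [M.effect_empty])
    (by
      intro D hD hdisj
      have h := Complex.hasSum_re (M.hasSum_iUnion D hD hdisj ψ ψ)
      rw [← h.tsum_eq]
      exact ENNReal.ofReal_tsum_of_nonneg
        (fun n => (M.isPositive _ (hD n)).re_inner_nonneg_right ψ) h.summable)

theorem measure_apply (M : POVM X H) (ψ : H) {D : Set X} (hD : MeasurableSet D) :
    M.measure ψ D = ENNReal.ofReal (⟪ψ, M.effect D ψ⟫_ℂ).re :=
  Measure.ofMeasurable_apply D hD

theorem measure_real_apply (M : POVM X H) (ψ : H) {D : Set X} (hD : MeasurableSet D) :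
    (M.measure ψ).real D = (⟪ψ, M.effect D ψ⟫_ℂ).re := by
  rw [Measure.real, M.measure_apply ψ hD, ENNReal.toReal_ofReal]
  exact (M.isPositive _ hD).re_inner_nonneg_right ψ

instance (M : POVM X H) (ψ : H) : IsFiniteMeasure (M.measure ψ) :=
  ⟨by rw [M.measure_apply ψ MeasurableSet.univ]; exact ENNReal.ofReal_lt_top⟩

theorem measure_real_univ (M : POVM X H) (ψ : H) : (M.measure ψ).real Set.univ = ‖ψ‖ ^ 2 := by
  rw [M.measure_real_apply ψ MeasurableSet.univ, M.effect_univ]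
  simpa using inner_self_eq_norm_sq (𝕜 := ℂ) ψ

open Classical in
/-- The operator `∫ f dM`, in the weak sense: the (unique) bounded operator `A` such that
`⟪ψ, A ψ⟫ = ∫ f(x) ⟪ψ, M(dx) ψ⟫` for all `ψ`. It exists for bounded measurable `f`, see
`POVM.inner_integral`. -/
def integral (M : POVM X H) (f : X → ℝ) : H →L[ℂ] H :=
  if h : ∃ A : H →L[ℂ] H, ∀ ψ, ⟪ψ, A ψ⟫_ℂ = ((∫ x, f x ∂(M.measure ψ) : ℝ) : ℂ)
  then h.choose else 0

/-- The integral of a simple function. -/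
def simpleIntegral (M : POVM X H) (s : SimpleFunc X ℝ) : H →L[ℂ] H :=
  ∑ c ∈ s.range, (c : ℂ) • M.effect (s ⁻¹' {c})

theorem simpleIntegral_isSelfAdjoint (M : POVM X H) (s : SimpleFunc X ℝ) :
    IsSelfAdjoint (M.simpleIntegral s) := by
  refine isSelfAdjoint_sum _ fun c _ => ?_
  refine IsSelfAdjoint.smul (Complex.conj_ofReal c) ?_
  exact (M.isPositive _ (s.measurableSet_preimage _)).isSelfAdjoint

theorem inner_simpleIntegral (M : POVM X H) (s : SimpleFunc X ℝ) (ψ : H) :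
    ⟪ψ, M.simpleIntegral s ψ⟫_ℂ = ((∫ x, s x ∂(M.measure ψ) : ℝ) : ℂ) := by
  rw [← SimpleFunc.integral_eq_integral s (SimpleFunc.integrable_of_isFiniteMeasure s),
    SimpleFunc.integral_eq, simpleIntegral, sum_apply, inner_sum]
  push_cast
  refine Finset.sum_congr rfl fun c _ => ?_
  have hp := M.isPositive _ (s.measurableSet_preimage {c})
  change ⟪ψ, (c : ℂ) • M.effect (s ⁻¹' {c}) ψ⟫_ℂ = _
  rw [inner_smul_right, M.measure_real_apply ψ (s.measurableSet_preimage {c}), smul_eq_mul, mul_comm]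
  push_cast
  congr 1
  exact (hp.isSymmetric.coe_re_inner_self_apply ψ).symm

theorem norm_le_of_abs_inner_le {T : H →L[ℂ] H} (hT : IsSelfAdjoint T) {ε : ℝ} (hε : 0 ≤ ε)
    (h : ∀ ψ, |(⟪ψ, T ψ⟫_ℂ).re| ≤ ε * ‖ψ‖ ^ 2) : ‖T‖ ≤ ε := by
  rw [T.norm_eq_iSup_rayleighQuotient hT.isSymmetric]
  refine Real.iSup_le (fun ψ => ?_) hε
  rw [ContinuousLinearMap.rayleighQuotient, abs_div, abs_sq]
  refine div_le_of_le_mul₀ (sq_nonneg _) hε ?_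
  have h' : ⟪T ψ, ψ⟫_ℂ = ⟪ψ, T ψ⟫_ℂ := hT.isSymmetric ψ ψ
  change |(⟪T ψ, ψ⟫_ℂ).re| ≤ _
  rw [h']
  exact h ψ

theorem exists_simpleFunc_approx {f : X → ℝ} (hf : Measurable f) {C : ℝ} (hC : ∀ x, |f x| ≤ C)
    {ε : ℝ} (hε : 0 < ε) : ∃ s : SimpleFunc X ℝ, ∀ x, |f x - s x| ≤ ε := by
  have hm : Measurable fun x => ε * (⌊f x / ε⌋ : ℝ) := by fun_prop
  refine ⟨⟨fun x => ε * (⌊f x / ε⌋ : ℝ), fun r => hm (measurableSet_singleton r), ?_⟩, fun x => ?_⟩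
  · refine ((Set.finite_Icc ⌊-C / ε⌋ ⌊C / ε⌋).image fun k : ℤ => ε * (k : ℝ)).subset ?_
    rintro _ ⟨x, rfl⟩
    have hx := abs_le.1 (hC x)
    refine ⟨⌊f x / ε⌋, ⟨Int.floor_mono ?_, Int.floor_mono ?_⟩, rfl⟩
    · exact div_le_div_of_nonneg_right hx.1 hε.le
    · exact div_le_div_of_nonneg_right hx.2 hε.le
  · change |f x - ε * (⌊f x / ε⌋ : ℝ)| ≤ ε
    have h1 : f x - ε * (⌊f x / ε⌋ : ℝ) = ε * Int.fract (f x / ε) := by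
      rw [Int.fract]; field_simp
    rw [h1, abs_of_nonneg (mul_nonneg hε.le (Int.fract_nonneg _))]
    exact mul_le_of_le_one_right hε.le (Int.fract_lt_one _).le

theorem abs_integral_sub_le (M : POVM X H) {f g : X → ℝ} (ψ : H)
    (hf : Integrable f (M.measure ψ)) (hg : Integrable g (M.measure ψ)) {ε : ℝ}
    (h : ∀ x, |f x - g x| ≤ ε) :
    |∫ x, f x ∂(M.measure ψ) - ∫ x, g x ∂(M.measure ψ)| ≤ ε * ‖ψ‖ ^ 2 := by
  rw [← integral_sub hf hg, ← M.measure_real_univ ψ, ← Real.norm_eq_abs]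
  exact norm_integral_le_of_norm_le_const (Filter.Eventually.of_forall fun x => h x)

theorem inner_integral (M : POVM X H) {f : X → ℝ} (hf : Measurable f) {C : ℝ}
    (hC : ∀ x, |f x| ≤ C) (ψ : H) :
    ⟪ψ, M.integral f ψ⟫_ℂ = ((∫ x, f x ∂(M.measure ψ) : ℝ) : ℂ) := by
  have hfi : ∀ ψ, Integrable f (M.measure ψ) := fun ψ =>
    Integrable.of_bound hf.aestronglyMeasurable C (Filter.Eventually.of_forall hC)
  have hsi : ∀ (s : SimpleFunc X ℝ) ψ, Integrable s (M.measure ψ) := fun s ψ =>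
    SimpleFunc.integrable_of_isFiniteMeasure s
  have hlim : Filter.Tendsto (fun n : ℕ => 1 / ((n : ℝ) + 1)) Filter.atTop (nhds 0) :=
    tendsto_one_div_add_atTop_nhds_zero_nat
  choose s hs using fun n : ℕ =>
    exists_simpleFunc_approx hf hC (Nat.one_div_pos_of_nat (α := ℝ) (n := n))
  have hcau : CauchySeq fun n => M.simpleIntegral (s n) := by
    refine cauchySeq_of_le_tendsto_0 (fun n : ℕ => 2 * (1 / ((n : ℝ) + 1))) ?_
      (by simpa using hlim.const_mul 2)
    intro n m N hn hm
    rw [dist_eq_norm]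
    have hle : ∀ k, N ≤ k → 1 / ((k : ℝ) + 1) ≤ 1 / ((N : ℝ) + 1) := fun k hk =>
      Nat.one_div_le_one_div hk
    refine norm_le_of_abs_inner_le ((M.simpleIntegral_isSelfAdjoint _).sub
      (M.simpleIntegral_isSelfAdjoint _)) (by positivity) fun φ => ?_
    have e : (⟪φ, (M.simpleIntegral (s n) - M.simpleIntegral (s m)) φ⟫_ℂ).re
        = ∫ x, s n x ∂(M.measure φ) - ∫ x, s m x ∂(M.measure φ) := by
      change (⟪φ, M.simpleIntegral (s n) φ - M.simpleIntegral (s m) φ⟫_ℂ).re = _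
      rw [inner_sub_right, M.inner_simpleIntegral, M.inner_simpleIntegral, ← Complex.ofReal_sub,
        Complex.ofReal_re]
    rw [e]
    refine M.abs_integral_sub_le φ (hsi _ _) (hsi _ _) fun x => ?_
    have h1 := abs_le.1 ((hs n x).trans (hle n hn))
    have h2 := abs_le.1 ((hs m x).trans (hle m hm))
    rw [abs_le]
    constructor <;> linarith [h1.1, h1.2, h2.1, h2.2]
  obtain ⟨A, hA⟩ := cauchySeq_tendsto_of_complete hcau
  have hex : ∃ A : H →L[ℂ] H, ∀ ψ, ⟪ψ, A ψ⟫_ℂ = ((∫ x, f x ∂(M.measure ψ) : ℝ) : ℂ) := by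
    refine ⟨A, fun φ => ?_⟩
    have t1 : Filter.Tendsto (fun n => ⟪φ, M.simpleIntegral (s n) φ⟫_ℂ) Filter.atTop
        (nhds ⟪φ, A φ⟫_ℂ) := by
      have c : Continuous fun T : H →L[ℂ] H => ⟪φ, T φ⟫_ℂ := by fun_prop
      exact (c.tendsto A).comp hA
    have t2 : Filter.Tendsto (fun n => ∫ x, s n x ∂(M.measure φ)) Filter.atTop
        (nhds (∫ x, f x ∂(M.measure φ))) := by
      rw [tendsto_iff_dist_tendsto_zero]
      have hlim' := hlim.mul_const (‖φ‖ ^ 2)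
      rw [zero_mul] at hlim'
      refine squeeze_zero (fun _ => dist_nonneg) (fun n => ?_) hlim'
      rw [dist_comm, Real.dist_eq]
      exact M.abs_integral_sub_le φ (hfi φ) (hsi _ _) (hs n)
    simp only [M.inner_simpleIntegral] at t1
    exact tendsto_nhds_unique t1 ((Complex.continuous_ofReal.tendsto _).comp t2)
  rw [integral, dif_pos hex]
  exact hex.choose_spec ψ

end POVM

end POVM

/-! ### Measurement scenarios and local hidden variable models -/

section Scenario

variable {Λ : Set ℝ} {H₁ H₂ : Type*}
  [NormedAddCommGroup H₁] [InnerProductSpace ℂ H₁] [CompleteSpace H₁]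
  [NormedAddCommGroup H₂] [InnerProductSpace ℂ H₂] [CompleteSpace H₂]

/-- The observable `∫ λ M(dλ)` measured on average by a POV measure with real outcomes. -/
def POVM.average (M : POVM Λ H₁) : H₁ →L[ℂ] H₁ := M.integral fun l => (l : ℝ)

/-- `P` is the joint probability distribution of the outcomes of the measurements `M` and `N` at
the two sites in the state `ρ`: `P(D₁ × D₂) = tr[ρ (M(D₁) ⊗ N(D₂))]`. -/
def IsJointDistribution (ρ : HTensor H₁ H₂ →L[ℂ] HTensor H₁ H₂) (M : POVM Λ H₁) (N : POVM Λ H₂)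
    (P : Measure (Λ × Λ)) : Prop :=
  IsProbabilityMeasure P ∧ ∀ D₁ D₂ : Set Λ, MeasurableSet D₁ → MeasurableSet D₂ →
    trace (ρ ∘L opTensor (M.effect D₁) (N.effect D₂)) = ((P.real (D₁ ×ˢ D₂) : ℝ) : ℂ)

open Classical in
/-- The joint probability distribution of the outcomes of `M` and `N` in the state `ρ`
(at most one measure has the defining property). -/
def jointDistribution (ρ : HTensor H₁ H₂ →L[ℂ] HTensor H₁ H₂) (M : POVM Λ H₁) (N : POVM Λ H₂) :
    Measure (Λ × Λ) :=
  if h : ∃ P, IsJointDistribution ρ M N P then h.choose else 0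

/-- The correlation function `⟨λ₁ λ₂⟩` of a joint distribution. -/
def correlation (P : Measure (Λ × Λ)) : ℝ := ∫ p, (p.1 : ℝ) * (p.2 : ℝ) ∂P

/-- The data of a local hidden variable model with two settings per site: a probability space of
hidden variables and, for each setting at each site, a conditional distribution of the outcome. The
settings `1, 2` are indexed by `0, 1 : Fin 2`. -/
structure LHVModel (Λ : Set ℝ) where
  Ω : Type
  [measurableSpace : MeasurableSpace Ω]
  ν : Measure Ω
  [isProbabilityMeasure : IsProbabilityMeasure ν]
  alice : Fin 2 → Kernel Ω Λ
  bob : Fin 2 → Kernel Ω Λ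
  [isMarkovKernel_alice : ∀ i, IsMarkovKernel (alice i)]
  [isMarkovKernel_bob : ∀ k, IsMarkovKernel (bob k)]

attribute [instance] LHVModel.measurableSpace LHVModel.isProbabilityMeasure
  LHVModel.isMarkovKernel_alice LHVModel.isMarkovKernel_bob

/-- The model reproduces the joint distributions:
`P i k (dλ₁ × dλ₂) = ∫ P₁ᵢ(dλ₁|ω) P₂ₖ(dλ₂|ω) ν(dω)`. -/
def LHVModel.Reproduces (m : LHVModel Λ) (P : Fin 2 → Fin 2 → Measure (Λ × Λ)) : Prop :=
  ∀ i k, P i k = m.ν.bind (m.alice i ×ₖ m.bob k)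

/-- The distribution `μ(dλ₁' × dλ₂ × dλ₂') = ∫ P₁₂(dλ₁'|ω) P₂₁(dλ₂|ω) P₂₂(dλ₂'|ω) ν(dω)` of the
outcomes under the second setting of Alice and both settings of Bob. -/
def LHVModel.tripleDistribution (m : LHVModel Λ) : Measure (Λ × Λ × Λ) :=
  m.ν.bind (m.alice 1 ×ₖ (m.bob 0 ×ₖ m.bob 1))

/-- The condition `∫ λ₂' (λ₂ - s λ₁') dμ ≥ 0`; the sign is `s = 1` in its minus sign form and
`s = -1` in its plus sign form. -/
def LHVModel.IsConditional (m : LHVModel Λ) (s : ℝ) : Prop :=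
  0 ≤ ∫ p, (p.2.2 : ℝ) * ((p.2.1 : ℝ) - s * (p.1 : ℝ)) ∂m.tripleDistribution

end Scenario

end QuantumBell

end

open QuantumBell

/-! Although `R` need not be positive, tensor positivity gives `tr[R (A ⊗ B ⊗ C)] ≥ 0` for positive
`A`, `B`, `C`: with square roots `a`, `b`, `c`, cyclicity makes this trace a sum of expectations of
`R` in product vectors. So for each setting `i` of Alice, the trace of `R` against an effect of `M₁
i` and effects of both of Bob's measurements is a nonnegative function of boxes, countably additive
in each slot. On standard Borel spaces it extends to a measure `μ i`, a joint law of Alice's outcome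
and both of Bob's outcomes.

Since both partial traces over `H₂` return `ρ`, the laws of (Alice, one Bob outcome) under `μ i` are
the quantum joint distributions. The law of Bob's pair comes from `σ_R` and does not involve `i`.
That pair can therefore serve as the hidden variable: Bob's outcomes are functions of it, and
Alice's kernels are the disintegrations of `μ 0` and `μ 1`.

For the inequality, integrate `|xy - xz| ≤ |y - z| ≤ 1 - yz` on `[-1, 1]` against `μ 0`. The mean of
`yz` is `tr[σ_R (B₁ ⊗ B₂)]`, which the sign assumption bounds below. In the constructed model, the
conditional integral equals the left side of that assumption.

The operator theory rests on `IsNuclear`: a self-adjoint trace class operator is a weak sum of `|u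
i⟩⟨v i|` with square summable vectors (`exists_isNuclear`), and trace identities become exchanges of
absolutely convergent sums. The main lemmas are `IsNuclear.trace_tsum_adjoint_comp` for partial
traces, `IsTensorPositive.trace_nonneg`, `POVM.hasSum_trace` for countable additivity, and
`exists_measure_prod₃` for the extension to a measure. -/

noncomputable section

namespace QuantumBell

/-! ### Algebra of product vectors and operators; product bases. -/

section TensorAlgebra

variable {E F G K L M : Type*}
  [NormedAddCommGroup E] [InnerProductSpace ℂ E] [NormedAddCommGroup F] [InnerProductSpace ℂ F]
  [NormedAddCommGroup G] [InnerProductSpace ℂ G] [NormedAddCommGroup K] [InnerProductSpace ℂ K]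
  [NormedAddCommGroup L] [InnerProductSpace ℂ L] [NormedAddCommGroup M] [InnerProductSpace ℂ M]

theorem inner_htmul (x x' : E) (y y' : F) :
    ⟪htmul x y, htmul x' y'⟫_ℂ = ⟪x, x'⟫_ℂ * ⟪y, y'⟫_ℂ := by
  simp [htmul]

theorem ext_htmul {S T : HTensor E F →L[ℂ] G} (h : ∀ x y, S (htmul x y) = T (htmul x y)) :
    S = T := by
  ext z
  induction z using UniformSpace.Completion.induction_on with
  | hp => exact isClosed_eq S.continuous T.continuous
  | ih z =>
    induction z using TensorProduct.induction_on with
    | zero => rw [UniformSpace.Completion.coe_zero, map_zero, map_zero]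
    | tmul x y => exact h x y
    | add a b ha hb => rw [UniformSpace.Completion.coe_add, map_add, map_add, ha, hb]

theorem eq_zero_of_inner_htmul {z : HTensor E F} (h : ∀ x y, ⟪htmul x y, z⟫_ℂ = 0) : z = 0 := by
  have h0 : ∀ w : HTensor E F, ⟪w, z⟫_ℂ = 0 := by
    intro w
    induction w using UniformSpace.Completion.induction_on with
    | hp => exact isClosed_eq (by fun_prop) continuous_const
    | ih w =>
      induction w using TensorProduct.induction_on with
      | zero => rw [UniformSpace.Completion.coe_zero, inner_zero_left]
      | tmul x y => exact h x y
      | add a b ha hb => rw [UniformSpace.Completion.coe_add, inner_add_left, ha, hb, add_zero]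
  exact inner_self_eq_zero.1 (h0 z)

theorem htmul_add_left (x x' : E) (y : F) : htmul (x + x') y = htmul x y + htmul x' y := by
  simp only [← insertRight_apply, map_add]

theorem htmul_add_right (x : E) (y y' : F) : htmul x (y + y') = htmul x y + htmul x y' := by
  simp only [← insertLeft_apply, map_add]

theorem htmul_smul_left (c : ℂ) (x : E) (y : F) : htmul (c • x) y = c • htmul x y := by
  simp only [← insertRight_apply, map_smul]

theorem htmul_smul_right (c : ℂ) (x : E) (y : F) : htmul x (c • y) = c • htmul x y := by
  simp only [← insertLeft_apply, map_smul]

theorem htmul_zero_left (y : F) : htmul (0 : E) y = 0 := by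
  simp only [← insertRight_apply, map_zero]

theorem htmul_zero_right (x : E) : htmul x (0 : F) = 0 := by
  simp only [← insertLeft_apply, map_zero]

theorem opTensor_comp_opTensor (A : E →L[ℂ] F) (B : G →L[ℂ] K) (A' : L →L[ℂ] E)
    (B' : M →L[ℂ] G) :
    opTensor A B ∘L opTensor A' B' = opTensor (A ∘L A') (B ∘L B') :=
  ext_htmul fun x y => by simp [opTensor_htmul]

theorem opTensor_one_one : opTensor (1 : E →L[ℂ] E) (1 : F →L[ℂ] F) = 1 :=
  ext_htmul fun x y => by simp [opTensor_htmul]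

theorem opTensor_sum_left {ι : Type*} (s : Finset ι) (c : ι → ℂ) (A : ι → E →L[ℂ] F)
    (B : G →L[ℂ] K) :
    opTensor (∑ i ∈ s, c i • A i) B = ∑ i ∈ s, c i • opTensor (A i) B := by
  classical
  refine ext_htmul fun x y => ?_
  induction s using Finset.induction_on with
  | empty => simp only [Finset.sum_empty, opTensor_htmul, zero_apply, htmul_zero_left]
  | insert a s ha ih =>
    rw [opTensor_htmul] at ih
    simp only [Finset.sum_insert ha, opTensor_htmul, add_apply, smul_apply, htmul_add_left,
      htmul_smul_left, ih]

theorem opTensor_sum_right {ι : Type*} (s : Finset ι) (c : ι → ℂ) (A : E →L[ℂ] F)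
    (B : ι → G →L[ℂ] K) :
    opTensor A (∑ i ∈ s, c i • B i) = ∑ i ∈ s, c i • opTensor A (B i) := by
  classical
  refine ext_htmul fun x y => ?_
  induction s using Finset.induction_on with
  | empty => simp only [Finset.sum_empty, opTensor_htmul, zero_apply, htmul_zero_right]
  | insert a s ha ih =>
    rw [opTensor_htmul] at ih
    simp only [Finset.sum_insert ha, opTensor_htmul, add_apply, smul_apply, htmul_add_right,
      htmul_smul_right, ih]

theorem opTensor_sub_left (A A' : E →L[ℂ] F) (B : G →L[ℂ] K) :
    opTensor (A - A') B = opTensor A B - opTensor A' B :=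
  ext_htmul fun x y => by
    simp only [opTensor_htmul, sub_apply]
    rw [eq_sub_iff_add_eq, ← htmul_add_left, sub_add_cancel]

theorem opTensor_sub_right (A : E →L[ℂ] F) (B B' : G →L[ℂ] K) :
    opTensor A (B - B') = opTensor A B - opTensor A B' :=
  ext_htmul fun x y => by
    simp only [opTensor_htmul, sub_apply]
    rw [eq_sub_iff_add_eq, ← htmul_add_right, sub_add_cancel]

theorem norm_opTensor_le (A : E →L[ℂ] F) (B : G →L[ℂ] K) : ‖opTensor A B‖ ≤ ‖A‖ * ‖B‖ := by
  refine ContinuousLinearMap.opNorm_le_bound _ (by positivity) fun z => ?_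
  induction z using UniformSpace.Completion.induction_on with
  | hp => exact isClosed_le (by fun_prop) (by fun_prop)
  | ih z =>
    simp only [opTensor, ContinuousLinearMap.completion_apply_coe, UniformSpace.Completion.norm_coe]
    exact ((TensorProduct.mapL A B).le_opNorm z).trans
      (mul_le_mul_of_nonneg_right (TensorProduct.norm_mapL_le A B) (norm_nonneg _))

theorem inner_ext_htmul {S T : HTensor E F →L[ℂ] HTensor G K}
    (h : ∀ x y x' y', ⟪htmul x y, S (htmul x' y')⟫_ℂ = ⟪htmul x y, T (htmul x' y')⟫_ℂ) : S = T := by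
  refine ext_htmul fun x' y' => ?_
  rw [← sub_eq_zero]
  refine eq_zero_of_inner_htmul fun x y => ?_
  rw [inner_sub_right, h, sub_self]

theorem adjoint_opTensor [CompleteSpace E] [CompleteSpace F] [CompleteSpace G] [CompleteSpace K]
    (A : E →L[ℂ] F) (B : G →L[ℂ] K) :
    ContinuousLinearMap.adjoint (opTensor A B) =
      opTensor (ContinuousLinearMap.adjoint A) (ContinuousLinearMap.adjoint B) := by
  refine inner_ext_htmul fun x y x' y' => ?_
  rw [ContinuousLinearMap.adjoint_inner_right, opTensor_htmul, opTensor_htmul, inner_htmul,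
    inner_htmul, ContinuousLinearMap.adjoint_inner_right, ContinuousLinearMap.adjoint_inner_right]

/-- The tensor product of two Hilbert bases. -/
theorem exists_hilbertBasis_htmul {ι κ : Type*} (b : HilbertBasis ι ℂ E) (c : HilbertBasis κ ℂ F) :
    ∃ d : HilbertBasis (ι × κ) ℂ (HTensor E F), ∀ p, d p = htmul (b p.1) (c p.2) := by
  classical
  have ho : Orthonormal ℂ fun p : ι × κ => htmul (b p.1) (c p.2) := by
    rw [orthonormal_iff_ite]
    rintro ⟨i, k⟩ ⟨i', k'⟩
    rw [inner_htmul, orthonormal_iff_ite.1 b.orthonormal, orthonormal_iff_ite.1 c.orthonormal]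
    by_cases h1 : i = i' <;> by_cases h2 : k = k' <;> simp [h1, h2]
  have hz : (Submodule.span ℂ (Set.range fun p : ι × κ => htmul (b p.1) (c p.2)))ᗮ = ⊥ := by
    rw [eq_bot_iff]
    intro z hz
    rw [Submodule.mem_orthogonal] at hz
    have h0 : ∀ i k, ⟪htmul (b i) (c k), z⟫_ℂ = 0 := fun i k =>
      hz _ (Submodule.subset_span ⟨(i, k), rfl⟩)
    -- Orthogonality to basis products spreads to all products by expanding one factor at a time.
    have h1 : ∀ i y, ⟪htmul (b i) y, z⟫_ℂ = 0 := by
      intro i y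
      have hs := (((c.hasSum_repr y).mapL (insertLeft F (b i))).mapL (innerSL ℂ z))
      have : ⟪z, htmul (b i) y⟫_ℂ = 0 := by
        refine hs.unique ?_
        convert hasSum_zero with k
        simp only [map_smul, insertLeft_apply, innerSL_apply_apply]
        rw [← inner_conj_symm, h0, map_zero, smul_zero]
      rw [← inner_conj_symm, this, map_zero]
    refine eq_zero_of_inner_htmul fun x y => ?_
    have hs := (((b.hasSum_repr x).mapL (insertRight E y)).mapL (innerSL ℂ z))
    have : ⟪z, htmul x y⟫_ℂ = 0 := by
      refine hs.unique ?_
      convert hasSum_zero with k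
      simp only [map_smul, insertRight_apply, innerSL_apply_apply]
      rw [← inner_conj_symm, h1, map_zero, smul_zero]
    rw [← inner_conj_symm, this, map_zero]
  exact ⟨HilbertBasis.mkOfOrthogonalEqBot ho hz, fun p => by simp⟩

end TensorAlgebra

/-! ### Resolutions of the identity by insertion operators. -/

section Parseval

variable {H K : Type*} [NormedAddCommGroup H] [InnerProductSpace ℂ H] [CompleteSpace H]
  [NormedAddCommGroup K] [InnerProductSpace ℂ K] [CompleteSpace K]

/-- Families of operators `V k : H → K` with `∑ k, V k (V k)† = 1` weakly. -/
def IsParseval {κ : Type*} (V : κ → H →L[ℂ] K) : Prop :=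
  ∀ x y : K, HasSum (fun k => ⟪ContinuousLinearMap.adjoint (V k) x,
    ContinuousLinearMap.adjoint (V k) y⟫_ℂ) ⟪x, y⟫_ℂ

/-- Parseval's identity for `d`, grouped by `k`: each group is Parseval's identity for `c`. -/
theorem isParseval_of_hilbertBasis {κ ι J : Type*} (V : κ → H →L[ℂ] K) (c : HilbertBasis J ℂ H)
    (d : HilbertBasis ι ℂ K) (e : κ × J ≃ ι) (h : ∀ k j, V k (c j) = d (e (k, j))) :
    IsParseval V := by
  intro x y
  have h1 := (e.hasSum_iff).2 (d.hasSum_inner_mul_inner x y)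
  refine h1.prod_fiberwise fun k => ?_
  convert c.hasSum_inner_mul_inner (ContinuousLinearMap.adjoint (V k) x)
    (ContinuousLinearMap.adjoint (V k) y) using 2 with j
  simp [← h, ContinuousLinearMap.adjoint_inner_left, ContinuousLinearMap.adjoint_inner_right]

theorem IsParseval.hasSum_norm_sq {κ : Type*} {V : κ → H →L[ℂ] K} (hV : IsParseval V) (x : K) :
    HasSum (fun k => ‖ContinuousLinearMap.adjoint (V k) x‖ ^ 2) (‖x‖ ^ 2) := by
  have h := Complex.hasSum_re (hV x x)
  have eH : ∀ z : H, (⟪z, z⟫_ℂ).re = ‖z‖ ^ 2 := fun z => inner_self_eq_norm_sq (𝕜 := ℂ) z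
  have eK : ∀ z : K, (⟪z, z⟫_ℂ).re = ‖z‖ ^ 2 := fun z => inner_self_eq_norm_sq (𝕜 := ℂ) z
  simpa only [eH, eK] using h

/-- Moving `S` to the left as an adjoint reduces this to the resolution of the identity, because the
adjoint of `V k` carries `S†` to `T†`. -/
theorem IsParseval.hasSum_inner {κ : Type*} {V : κ → H →L[ℂ] K} (hV : IsParseval V)
    {S : K →L[ℂ] K} {T : H →L[ℂ] H} (h : ∀ k, S ∘L V k = V k ∘L T) (x y : K) :
    HasSum (fun k => ⟪ContinuousLinearMap.adjoint (V k) x,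
      T (ContinuousLinearMap.adjoint (V k) y)⟫_ℂ) ⟪x, S y⟫_ℂ := by
  rw [← ContinuousLinearMap.adjoint_inner_left]
  convert hV (ContinuousLinearMap.adjoint S x) y using 2 with k
  have hk := DFunLike.congr_fun (h k) (ContinuousLinearMap.adjoint (V k) y)
  simp only [ContinuousLinearMap.comp_apply] at hk
  rw [ContinuousLinearMap.adjoint_inner_left, ← hk, ContinuousLinearMap.adjoint_inner_left,
    ContinuousLinearMap.adjoint_inner_left]

variable {E F G : Type*}
  [NormedAddCommGroup E] [InnerProductSpace ℂ E] [CompleteSpace E]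
  [NormedAddCommGroup F] [InnerProductSpace ℂ F] [CompleteSpace F]
  [NormedAddCommGroup G] [InnerProductSpace ℂ G] [CompleteSpace G]

theorem isParseval_insertLeft : IsParseval fun i => insertLeft F (basis E i) := by
  obtain ⟨d, hd⟩ := exists_hilbertBasis_htmul (basis E) (basis F)
  exact isParseval_of_hilbertBasis _ (basis F) d (Equiv.refl _) fun k j => by
    simp [hd, insertLeft_apply]

theorem isParseval_insertRight : IsParseval fun i => insertRight E (basis F i) := by
  obtain ⟨d, hd⟩ := exists_hilbertBasis_htmul (basis E) (basis F)
  exact isParseval_of_hilbertBasis _ (basis E) d (Equiv.prodComm _ _) fun k j => by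
    simp [hd, insertRight_apply]

theorem isParseval_opTensor_insertLeft :
    IsParseval fun i => opTensor (ContinuousLinearMap.id ℂ E) (insertLeft G (basis F i)) := by
  obtain ⟨d, hd⟩ := exists_hilbertBasis_htmul (basis F) (basis G)
  obtain ⟨d', hd'⟩ := exists_hilbertBasis_htmul (basis E) d
  obtain ⟨c, hc⟩ := exists_hilbertBasis_htmul (basis E) (basis G)
  refine isParseval_of_hilbertBasis _ c d'
    ⟨fun p => (p.2.1, (p.1, p.2.2)), fun p => (p.2.1, (p.1, p.2.2)), fun _ => rfl, fun _ => rfl⟩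
    fun k j => ?_
  simp [hd, hd', hc, opTensor_htmul, insertLeft_apply]

theorem isParseval_opTensor_insertRight :
    IsParseval fun i => opTensor (ContinuousLinearMap.id ℂ E) (insertRight F (basis G i)) := by
  obtain ⟨d, hd⟩ := exists_hilbertBasis_htmul (basis F) (basis G)
  obtain ⟨d', hd'⟩ := exists_hilbertBasis_htmul (basis E) d
  obtain ⟨c, hc⟩ := exists_hilbertBasis_htmul (basis E) (basis F)
  refine isParseval_of_hilbertBasis _ c d'
    ⟨fun p => (p.2.1, (p.2.2, p.1)), fun p => (p.2.2, (p.1, p.2.1)), fun _ => rfl, fun _ => rfl⟩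
    fun k j => ?_
  simp [hd, hd', hc, opTensor_htmul, insertRight_apply]

end Parseval


/-! ### Nuclear representations, traces and partial traces. -/

section Nuclear

variable {H K : Type*} [NormedAddCommGroup H] [InnerProductSpace ℂ H] [CompleteSpace H]
  [NormedAddCommGroup K] [InnerProductSpace ℂ K] [CompleteSpace K] {ι J κ : Type*}

theorem norm_inner_le_half (x y : H) : ‖⟪x, y⟫_ℂ‖ ≤ (‖y‖ ^ 2 + ‖x‖ ^ 2) / 2 := by
  have := norm_inner_le_norm (𝕜 := ℂ) x y
  nlinarith [sq_nonneg (‖x‖ - ‖y‖)]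

theorem hasSum_norm_inner_sq (d : HilbertBasis J ℂ H) (x : H) :
    HasSum (fun j => ‖⟪d j, x⟫_ℂ‖ ^ 2) (‖x‖ ^ 2) := by
  have h := Complex.hasSum_re (d.hasSum_inner_mul_inner x x)
  have e : (⟪x, x⟫_ℂ).re = ‖x‖ ^ 2 := inner_self_eq_norm_sq (𝕜 := ℂ) x
  rw [e] at h
  convert h using 2 with j
  rw [← inner_conj_symm x (d j), ← Complex.normSq_eq_conj_mul_self, Complex.ofReal_re,
    Complex.normSq_eq_norm_sq]

/-- `R = ∑ i, |u i⟩⟨v i|` weakly, with square summable families of vectors. -/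
structure IsNuclear (R : H →L[ℂ] H) (u v : ι → H) : Prop where
  summable_left : Summable fun i => ‖u i‖ ^ 2
  summable_right : Summable fun i => ‖v i‖ ^ 2
  hasSum : ∀ x y, HasSum (fun i => ⟪x, u i⟫_ℂ * ⟪v i, y⟫_ℂ) ⟪x, R y⟫_ℂ

/-- For fixed `i` the sum over `k` is exactly `‖u i‖ ^ 2`, so splitting the vectors preserves the
total. -/
theorem summable_norm_adjoint_sq {W : κ → H →L[ℂ] K} (hW : IsParseval W) {u : ι → K}
    (hu : Summable fun i => ‖u i‖ ^ 2) :
    Summable fun p : κ × ι => ‖ContinuousLinearMap.adjoint (W p.1) (u p.2)‖ ^ 2 := by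
  have h : Summable fun p : ι × κ => ‖ContinuousLinearMap.adjoint (W p.2) (u p.1)‖ ^ 2 := by
    rw [summable_prod_of_nonneg fun p => by positivity]
    refine ⟨fun i => (hW.hasSum_norm_sq (u i)).summable, ?_⟩
    simpa only [(hW.hasSum_norm_sq _).tsum_eq] using hu
  exact (Equiv.prodComm κ ι).summable_iff.2 h

namespace IsNuclear

variable {R : H →L[ℂ] H} {u v : ι → H}

theorem summable_half (h : IsNuclear R u v) : Summable fun i => (‖u i‖ ^ 2 + ‖v i‖ ^ 2) / 2 :=
  (h.summable_left.add h.summable_right).div_const 2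

theorem norm_inner_apply_le (T : H →L[ℂ] H) (x y : H) :
    ‖⟪x, T y⟫_ℂ‖ ≤ ‖T‖ * ((‖y‖ ^ 2 + ‖x‖ ^ 2) / 2) := by
  have h1 := norm_inner_le_norm (𝕜 := ℂ) x (T y)
  have h2 := T.le_opNorm y
  have h3 : ‖x‖ * ‖T y‖ ≤ ‖x‖ * (‖T‖ * ‖y‖) := by gcongr
  nlinarith [mul_nonneg (norm_nonneg T) (sq_nonneg (‖x‖ - ‖y‖))]

theorem summable_inner_apply (h : IsNuclear R u v) (T : H →L[ℂ] H) :
    Summable fun i => ⟪v i, T (u i)⟫_ℂ :=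
  Summable.of_norm_bounded (h.summable_half.mul_left ‖T‖) fun _ => norm_inner_apply_le T _ _

/-- The right side replaces the trace norm throughout; here it will make the series of a partial
trace converge in operator norm. -/
theorem norm_le (h : IsNuclear R u v) : ‖R‖ ≤ ∑' i, (‖u i‖ ^ 2 + ‖v i‖ ^ 2) / 2 := by
  have h0 : 0 ≤ ∑' i, (‖u i‖ ^ 2 + ‖v i‖ ^ 2) / 2 := tsum_nonneg fun i => by positivity
  refine ContinuousLinearMap.opNorm_le_of_re_inner_le h0 fun x y hx hy => ?_
  refine (RCLike.re_le_norm (K := ℂ) _).trans ?_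
  rw [norm_inner_symm, ← (h.hasSum y x).tsum_eq]
  refine tsum_of_norm_bounded h.summable_half.hasSum fun i => ?_
  have h1 := norm_inner_le_norm (𝕜 := ℂ) y (u i)
  have h2 := norm_inner_le_norm (𝕜 := ℂ) (v i) x
  rw [hy, one_mul] at h1
  rw [hx, mul_one] at h2
  rw [norm_mul]
  have h3 := mul_le_mul h1 h2 (norm_nonneg _) (norm_nonneg _)
  nlinarith [sq_nonneg (‖u i‖ - ‖v i‖)]

theorem comp (h : IsNuclear R u v) (S : H →L[ℂ] K) (T : K →L[ℂ] H) :
    IsNuclear (S ∘L R ∘L T) (fun i => S (u i))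
      (fun i => ContinuousLinearMap.adjoint T (v i)) where
  summable_left := by
    refine Summable.of_nonneg_of_le (fun _ => by positivity) (fun i => ?_)
      (h.summable_left.mul_left (‖S‖ ^ 2))
    rw [← mul_pow]
    gcongr
    exact S.le_opNorm _
  summable_right := by
    refine Summable.of_nonneg_of_le (fun _ => by positivity) (fun i => ?_)
      (h.summable_right.mul_left (‖ContinuousLinearMap.adjoint T‖ ^ 2))
    rw [← mul_pow]
    gcongr
    exact (ContinuousLinearMap.adjoint T).le_opNorm _
  hasSum x y := by
    have := h.hasSum (ContinuousLinearMap.adjoint S x) (T y)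
    simpa only [ContinuousLinearMap.adjoint_inner_left, ContinuousLinearMap.comp_apply] using this

/-- The double family over `(i, j)` is absolutely summable, so it may be summed over `j` first
(Parseval) or over `i` first (diagonal entries of `R`). Hence the trace is independent of the basis.
-/
theorem hasSum_hilbertBasis (h : IsNuclear R u v) (d : HilbertBasis J ℂ H) :
    HasSum (fun j => ⟪d j, R (d j)⟫_ℂ) (∑' i, ⟪v i, u i⟫_ℂ) := by
  have hs : ∀ w : ι → H, (Summable fun i => ‖w i‖ ^ 2) →
      Summable fun p : ι × J => ‖⟪d p.2, w p.1⟫_ℂ‖ ^ 2 := by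
    intro w hw
    rw [summable_prod_of_nonneg fun p => by positivity]
    refine ⟨fun i => (hasSum_norm_inner_sq d (w i)).summable, ?_⟩
    simpa only [(hasSum_norm_inner_sq d _).tsum_eq] using hw
  have hf : Summable fun p : ι × J => ⟪v p.1, d p.2⟫_ℂ * ⟪d p.2, u p.1⟫_ℂ := by
    refine Summable.of_norm_bounded
      (((hs u h.summable_left).add (hs v h.summable_right)).div_const 2) fun p => ?_
    rw [norm_mul, norm_inner_symm]
    nlinarith [sq_nonneg (‖⟪d p.2, u p.1⟫_ℂ‖ - ‖⟪d p.2, v p.1⟫_ℂ‖)]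
  have h1 := hf.hasSum.prod_fiberwise fun i => d.hasSum_inner_mul_inner (v i) (u i)
  rw [h1.tsum_eq]
  refine ((Equiv.prodComm J ι).hasSum_iff.2 hf.hasSum).prod_fiberwise fun j => ?_
  simpa [mul_comm] using h.hasSum (d j) (d j)

theorem trace_eq (h : IsNuclear R u v) : trace R = ∑' i, ⟪v i, u i⟫_ℂ :=
  (h.hasSum_hilbertBasis (basis H)).tsum_eq

theorem trace_comp_eq (h : IsNuclear R u v) (T : H →L[ℂ] H) :
    trace (R ∘L T) = ∑' i, ⟪v i, T (u i)⟫_ℂ := by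
  have := (h.comp (ContinuousLinearMap.id ℂ H) T).trace_eq
  simpa only [ContinuousLinearMap.id_comp, ContinuousLinearMap.id_apply,
    ContinuousLinearMap.adjoint_inner_left] using this

theorem hasSum_trace_comp (h : IsNuclear R u v) (T : H →L[ℂ] H) :
    HasSum (fun i => ⟪v i, T (u i)⟫_ℂ) (trace (R ∘L T)) := by
  rw [h.trace_comp_eq]
  exact (h.summable_inner_apply T).hasSum

theorem norm_trace_comp_le (h : IsNuclear R u v) (T : H →L[ℂ] H) :
    ‖trace (R ∘L T)‖ ≤ ‖T‖ * ∑' i, (‖u i‖ ^ 2 + ‖v i‖ ^ 2) / 2 := by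
  rw [h.trace_comp_eq, ← tsum_mul_left]
  exact tsum_of_norm_bounded (h.summable_half.mul_left ‖T‖).hasSum
    fun _ => norm_inner_apply_le T _ _

/-- The trace is cyclic, and can be computed in any Hilbert basis. -/
theorem hasSum_trace_comp_comp (h : IsNuclear R u v) (S T : H →L[ℂ] H) (d : HilbertBasis J ℂ H) :
    HasSum (fun j => ⟪d j, S (R (T (d j)))⟫_ℂ) (trace (R ∘L T ∘L S)) := by
  have h1 := (h.comp S T).hasSum_hilbertBasis d
  rw [h.trace_comp_eq]
  simpa only [ContinuousLinearMap.comp_apply, ContinuousLinearMap.adjoint_inner_left] using h1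

theorem trace_comp_sub (h : IsNuclear R u v) (S T : H →L[ℂ] H) :
    trace (R ∘L (S - T)) = trace (R ∘L S) - trace (R ∘L T) := by
  refine HasSum.unique (h.hasSum_trace_comp _) ?_
  simpa only [sub_apply, inner_sub_right] using
    (h.hasSum_trace_comp S).sub (h.hasSum_trace_comp T)

theorem trace_comp_sum (h : IsNuclear R u v) (s : Finset κ) (c : κ → ℂ) (T : κ → H →L[ℂ] H) :
    trace (R ∘L ∑ k ∈ s, c k • T k) = ∑ k ∈ s, c k * trace (R ∘L T k) := by
  refine HasSum.unique (h.hasSum_trace_comp _) ?_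
  simpa only [sum_apply, smul_apply, inner_sum, inner_smul_right] using
    hasSum_sum fun k (_ : k ∈ s) => (h.hasSum_trace_comp (T k)).mul_left (c k)

theorem sub {R' : H →L[ℂ] H} {u' v' : J → H} (h : IsNuclear R u v) (h' : IsNuclear R' u' v') :
    IsNuclear (R - R') (Sum.elim u fun j => -u' j) (Sum.elim v v') where
  summable_left := Summable.sum _ (by simpa [Function.comp_def] using h.summable_left)
    (by simpa [Function.comp_def] using h'.summable_left)
  summable_right := Summable.sum _ (by simpa [Function.comp_def] using h.summable_right)
    (by simpa [Function.comp_def] using h'.summable_right)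
  hasSum x y := by
    rw [sub_apply, inner_sub_right, sub_eq_add_neg]
    refine HasSum.sum (by simpa [Function.comp_def] using h.hasSum x y) ?_
    simpa [Function.comp_def] using (h'.hasSum x y).neg

section PartialTrace

variable {R : K →L[ℂ] K} {u v : ι → K} {W : κ → H →L[ℂ] K}

/-- Each summand is nuclear with the compressed vectors, and these remain square summable over all
pairs. By `norm_le` the operator series converges in norm, so its matrix elements may be computed
termwise and regrouped. -/
theorem isNuclear_tsum_adjoint_comp (h : IsNuclear R u v) (hW : IsParseval W) :
    IsNuclear (∑' k, ContinuousLinearMap.adjoint (W k) ∘L R ∘L W k)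
      (fun p : κ × ι => ContinuousLinearMap.adjoint (W p.1) (u p.2))
      (fun p : κ × ι => ContinuousLinearMap.adjoint (W p.1) (v p.2)) := by
  have hu := summable_norm_adjoint_sq hW h.summable_left
  have hv := summable_norm_adjoint_sq hW h.summable_right
  refine ⟨hu, hv, fun x y => ?_⟩
  have hhalf := (hu.add hv).div_const 2
  have hk : ∀ k, IsNuclear (ContinuousLinearMap.adjoint (W k) ∘L R ∘L W k) _ _ := fun k =>
    h.comp (ContinuousLinearMap.adjoint (W k)) (W k)
  have hs : Summable fun k => ContinuousLinearMap.adjoint (W k) ∘L R ∘L W k :=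
    Summable.of_norm_bounded hhalf.prod fun k => (hk k).norm_le
  have hf : Summable fun p : κ × ι => ⟪x, ContinuousLinearMap.adjoint (W p.1) (u p.2)⟫_ℂ *
      ⟪ContinuousLinearMap.adjoint (W p.1) (v p.2), y⟫_ℂ := by
    refine Summable.of_norm_bounded (hhalf.mul_right (‖x‖ * ‖y‖)) fun p => ?_
    rw [norm_mul]
    set a := ContinuousLinearMap.adjoint (W p.1) (u p.2)
    set b := ContinuousLinearMap.adjoint (W p.1) (v p.2)
    have h1 := norm_inner_le_norm (𝕜 := ℂ) x a
    have h2 := norm_inner_le_norm (𝕜 := ℂ) b y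
    calc _ ≤ (‖x‖ * ‖a‖) * (‖b‖ * ‖y‖) := by gcongr
      _ = (‖a‖ * ‖b‖) * (‖x‖ * ‖y‖) := by ring
      _ ≤ _ := by
        gcongr
        nlinarith [sq_nonneg (‖a‖ - ‖b‖)]
  have h1 := hf.hasSum.prod_fiberwise fun k => (hk k).hasSum x y
  have h2 := (hs.hasSum.mapL (ContinuousLinearMap.apply ℂ H y)).mapL (innerSL ℂ x)
  have h3 : ⟪x, (∑' k, ContinuousLinearMap.adjoint (W k) ∘L R ∘L W k) y⟫_ℂ = _ := h2.unique h1
  rw [h3]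
  exact hf.hasSum

/-- The duality characterizing a partial trace. Summing the nuclear expansion over `k` first,
`IsParseval.hasSum_inner` reassembles `S` from copies of `T`. -/
theorem trace_tsum_adjoint_comp (h : IsNuclear R u v) (hW : IsParseval W) {S : K →L[ℂ] K}
    {T : H →L[ℂ] H} (hST : ∀ k, S ∘L W k = W k ∘L T) :
    trace ((∑' k, ContinuousLinearMap.adjoint (W k) ∘L R ∘L W k) ∘L T) = trace (R ∘L S) := by
  have h1 := (h.isNuclear_tsum_adjoint_comp hW).hasSum_trace_comp T
  have h2 := ((Equiv.prodComm ι κ).hasSum_iff.2 h1).prod_fiberwise fun i =>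
    hW.hasSum_inner hST (v i) (u i)
  exact h2.unique (h.hasSum_trace_comp S)

end PartialTrace

end IsNuclear

/-- A positive operator is `S† S` with `S` positive. -/
theorem exists_adjoint_comp_self {T : H →L[ℂ] H} (hT : T.IsPositive) :
    ∃ S : H →L[ℂ] H, ContinuousLinearMap.adjoint S = S ∧ S ∘L S = T := by
  have h0 : 0 ≤ T := (ContinuousLinearMap.nonneg_iff_isPositive T).2 hT
  refine ⟨CFC.sqrt T, ?_, CFC.sqrt_mul_sqrt_self T h0⟩
  exact (CFC.sqrt_nonneg T).isSelfAdjoint.star_eq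

/-- The square root `S` of `T` is Hilbert–Schmidt, and Parseval for `⟪S x, S y⟫` gives the expansion
with `u = v = S eᵢ`. -/
theorem isNuclear_of_isPositive {T : H →L[ℂ] H} (hT : T.IsPositive)
    (h : Summable fun i => (⟪basis H i, T (basis H i)⟫_ℂ).re) :
    ∃ u v : basisIndex H → H, IsNuclear T u v := by
  obtain ⟨S, hS, rfl⟩ := exists_adjoint_comp_self hT
  have hS' : ∀ x y, ⟪x, S y⟫_ℂ = ⟪S x, y⟫_ℂ := fun x y => by
    rw [← ContinuousLinearMap.adjoint_inner_left, hS]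
  have hs : Summable fun i => ‖S (basis H i)‖ ^ 2 := by
    convert h using 2 with i
    rw [ContinuousLinearMap.comp_apply, hS']
    exact (inner_self_eq_norm_sq (𝕜 := ℂ) (S (basis H i))).symm
  refine ⟨fun i => S (basis H i), fun i => S (basis H i), hs, hs, fun x y => ?_⟩
  simpa only [hS', ContinuousLinearMap.comp_apply] using
    (basis H).hasSum_inner_mul_inner (S x) (S y)

/-- Both parts of the decomposition `T = T⁺ - T⁻` have diagonal entries dominated by those of `|T| =
T⁺ + T⁻`, so the positive case applies to each. -/
theorem exists_isNuclear {T : H →L[ℂ] H} (hT : IsSelfAdjoint T) (h : IsTraceClass T) :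
    ∃ u v : basisIndex H ⊕ basisIndex H → H, IsNuclear T u v := by
  have habs : T⁺ + T⁻ = CFC.abs T := CFC.posPart_add_negPart T hT
  have hp : (T⁺).IsPositive :=
    (ContinuousLinearMap.nonneg_iff_isPositive _).1 (CFC.posPart_nonneg T)
  have hn : (T⁻).IsPositive :=
    (ContinuousLinearMap.nonneg_iff_isPositive _).1 (CFC.negPart_nonneg T)
  have hre : ∀ x, (⟪x, CFC.abs T x⟫_ℂ).re = (⟪x, T⁺ x⟫_ℂ).re + (⟪x, T⁻ x⟫_ℂ).re := fun x => by
    rw [← habs, add_apply, inner_add_right, Complex.add_re]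
  have h1 : ∀ x, 0 ≤ (⟪x, T⁺ x⟫_ℂ).re := fun x => hp.re_inner_nonneg_right x
  have h2 : ∀ x, 0 ≤ (⟪x, T⁻ x⟫_ℂ).re := fun x => hn.re_inner_nonneg_right x
  obtain ⟨u, v, huv⟩ := isNuclear_of_isPositive hp
    (Summable.of_nonneg_of_le (fun i => h1 _) (fun i => by rw [hre]; linarith [h2 (basis H i)]) h)
  obtain ⟨u', v', huv'⟩ := isNuclear_of_isPositive hn
    (Summable.of_nonneg_of_le (fun i => h2 _) (fun i => by rw [hre]; linarith [h1 (basis H i)]) h)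
  have := huv.sub huv'
  rw [CFC.posPart_sub_negPart T hT] at this
  exact ⟨_, _, this⟩

end Nuclear


/-! ### Countable additivity of traces against effects; operator integrals. -/

section Effects

variable {X Y : Type*} [MeasurableSpace X] [MeasurableSpace Y]
  {H K : Type*} [NormedAddCommGroup H] [InnerProductSpace ℂ H] [CompleteSpace H]
  [NormedAddCommGroup K] [InnerProductSpace ℂ K] [CompleteSpace K] {ι κ : Type*}

/-- Cauchy–Schwarz for the form of `T`. Unlike a bound by `‖T‖`, it keeps a right side that is
additive over disjoint effects. -/
theorem norm_inner_apply_le_of_isPositive {T : H →L[ℂ] H} (hT : T.IsPositive) (x y : H) :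
    ‖⟪x, T y⟫_ℂ‖ ≤ ((⟪y, T y⟫_ℂ).re + (⟪x, T x⟫_ℂ).re) / 2 := by
  obtain ⟨S, hS, rfl⟩ := exists_adjoint_comp_self hT
  have hS' : ∀ x y, ⟪x, (S ∘L S) y⟫_ℂ = ⟪S x, S y⟫_ℂ := fun x y => by
    rw [ContinuousLinearMap.comp_apply, ← ContinuousLinearMap.adjoint_inner_left, hS]
  have e : ∀ z : H, (⟪z, z⟫_ℂ).re = ‖z‖ ^ 2 := fun z => inner_self_eq_norm_sq (𝕜 := ℂ) z
  rw [hS', hS', hS', e, e]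
  exact norm_inner_le_half _ _

namespace POVM

/-- An exchange of the sums over `i` and `n`. Absolute summability follows from the nonnegative
diagonal terms, whose sum over `n` is an expectation of the effect of the union. -/
theorem hasSum_iUnion_tsum (M : POVM X H) {u v : ι → H} (hu : Summable fun i => ‖u i‖ ^ 2)
    (hv : Summable fun i => ‖v i‖ ^ 2) {D : ℕ → Set X} (hD : ∀ n, MeasurableSet (D n))
    (hdisj : Pairwise (Function.onFun Disjoint D)) :
    HasSum (fun n => ∑' i, ⟪v i, M.effect (D n) (u i)⟫_ℂ)
      (∑' i, ⟪v i, M.effect (⋃ n, D n) (u i)⟫_ℂ) := by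
  have hs : ∀ w : ι → H, (Summable fun i => ‖w i‖ ^ 2) →
      Summable fun p : ι × ℕ => (⟪w p.1, M.effect (D p.2) (w p.1)⟫_ℂ).re := by
    intro w hw
    have hnn : ∀ p : ι × ℕ, 0 ≤ (⟪w p.1, M.effect (D p.2) (w p.1)⟫_ℂ).re := fun p =>
      (M.isPositive _ (hD p.2)).re_inner_nonneg_right _
    rw [summable_prod_of_nonneg hnn]
    have h1 := fun i => Complex.hasSum_re (M.hasSum_iUnion D hD hdisj (w i) (w i))
    refine ⟨fun i => (h1 i).summable, ?_⟩
    simp only [(h1 _).tsum_eq]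
    refine Summable.of_norm_bounded (hw.mul_left ‖M.effect (⋃ n, D n)‖) fun i => ?_
    have h2 := IsNuclear.norm_inner_apply_le (M.effect (⋃ n, D n)) (w i) (w i)
    rw [add_self_div_two] at h2
    exact (Complex.abs_re_le_norm _).trans h2
  have hf : Summable fun p : ι × ℕ => ⟪v p.1, M.effect (D p.2) (u p.1)⟫_ℂ :=
    Summable.of_norm_bounded (((hs u hu).add (hs v hv)).div_const 2) fun p =>
      norm_inner_apply_le_of_isPositive (M.isPositive _ (hD p.2)) _ _
  have h1 := hf.hasSum.prod_fiberwise fun i => M.hasSum_iUnion D hD hdisj (v i) (u i)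
  rw [h1.tsum_eq]
  have hf' := (Equiv.prodComm ℕ ι).summable_iff.2 hf
  exact ((Equiv.prodComm ℕ ι).hasSum_iff.2 hf.hasSum).prod_fiberwise fun n =>
    (hf'.prod_factor n).hasSum

/-- The POV measure on `K` with effects `eff D = ∑ k, W k M(D) (W k)†`. -/
def amplify (M : POVM X H) {W : κ → H →L[ℂ] K} (hW : IsParseval W) (eff : Set X → K →L[ℂ] K)
    (heff : ∀ D k, eff D ∘L W k = W k ∘L M.effect D) (huniv : eff Set.univ = 1) : POVM X K where
  effect := eff
  isPositive D hD := by
    have h := fun x y => hW.hasSum_inner (heff D) x y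
    refine ⟨fun x y => ?_, fun x => ?_⟩
    · change ⟪eff D x, y⟫_ℂ = ⟪x, eff D y⟫_ℂ
      rw [← inner_conj_symm]
      refine HasSum.unique ((h y x).map (starRingEnd ℂ) Complex.continuous_conj) ?_
      convert h x y using 2 with k
      simp only [Function.comp_apply]
      rw [inner_conj_symm]
      exact (M.isPositive D hD).isSymmetric _ _
    · rw [ContinuousLinearMap.reApplyInnerSelf_apply, ← inner_re_symm]
      exact (Complex.hasSum_re (h x x)).nonneg fun k =>
        (M.isPositive D hD).re_inner_nonneg_right _
  effect_univ := huniv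
  hasSum_iUnion D hD hdisj φ ψ := by
    have h := M.hasSum_iUnion_tsum (hW.hasSum_norm_sq ψ).summable (hW.hasSum_norm_sq φ).summable
      hD hdisj
    simpa only [(hW.hasSum_inner (heff _) φ ψ).tsum_eq] using h

/-- The POV measure `D ↦ M(D) ⊗ 1`. -/
def ampRight (M : POVM X H) (K : Type*) [NormedAddCommGroup K] [InnerProductSpace ℂ K]
    [CompleteSpace K] : POVM X (HTensor H K) :=
  M.amplify isParseval_insertRight (fun D => opTensor (M.effect D) 1)
    (fun D k => by ext x; simp [insertRight_apply, opTensor_htmul])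
    (by rw [M.effect_univ, opTensor_one_one])

/-- The POV measure `D ↦ 1 ⊗ M(D)`. -/
def ampLeft (M : POVM X H) (K : Type*) [NormedAddCommGroup K] [InnerProductSpace ℂ K]
    [CompleteSpace K] : POVM X (HTensor K H) :=
  M.amplify isParseval_insertLeft (fun D => opTensor 1 (M.effect D))
    (fun D k => by ext x; simp [insertLeft_apply, opTensor_htmul])
    (by rw [M.effect_univ, opTensor_one_one])

theorem ampRight_effect (M : POVM X H) (D : Set X) :
    (M.ampRight K).effect D = opTensor (M.effect D) 1 := rfl

theorem ampLeft_effect (M : POVM X H) (D : Set X) :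
    (M.ampLeft K).effect D = opTensor 1 (M.effect D) := rfl

/-- The factor `S` will carry the effects in the other slots. `R ∘L S` need not be self-adjoint but
is still nuclear, which is why the two families `u` and `v` are kept separate. -/
theorem hasSum_trace (M : POVM X H) {R : H →L[ℂ] H} {u v : ι → H} (h : IsNuclear R u v)
    (S : H →L[ℂ] H) {D : ℕ → Set X} (hD : ∀ n, MeasurableSet (D n))
    (hdisj : Pairwise (Function.onFun Disjoint D)) :
    HasSum (fun n => trace (R ∘L S ∘L M.effect (D n)))
      (trace (R ∘L S ∘L M.effect (⋃ n, D n))) := by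
  have h1 := h.comp (ContinuousLinearMap.id ℂ H) S
  rw [ContinuousLinearMap.id_comp] at h1
  have h2 := M.hasSum_iUnion_tsum h1.summable_left h1.summable_right hD hdisj
  simp only [← ContinuousLinearMap.comp_assoc R S]
  simpa only [h1.trace_comp_eq] using h2

theorem isSelfAdjoint_integral (M : POVM X H) {f : X → ℝ} (hf : Measurable f) {C : ℝ}
    (hC : ∀ x, |f x| ≤ C) : IsSelfAdjoint (M.integral f) := by
  rw [ContinuousLinearMap.isSelfAdjoint_iff_isSymmetric, LinearMap.isSymmetric_iff_inner_map_self_real]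
  intro ψ
  have h := M.inner_integral hf hC ψ
  change (starRingEnd ℂ) ⟪M.integral f ψ, ψ⟫_ℂ = ⟪M.integral f ψ, ψ⟫_ℂ
  rw [← inner_conj_symm, h, Complex.conj_ofReal, Complex.conj_ofReal]

theorem norm_integral_sub_simpleIntegral_le (M : POVM X H) {f : X → ℝ} (hf : Measurable f) {C : ℝ}
    (hC : ∀ x, |f x| ≤ C) (s : SimpleFunc X ℝ) {ε : ℝ} (hε : 0 ≤ ε) (hs : ∀ x, |f x - s x| ≤ ε) :
    ‖M.simpleIntegral s - M.integral f‖ ≤ ε := by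
  rw [norm_sub_rev]
  refine norm_le_of_abs_inner_le
    ((M.isSelfAdjoint_integral hf hC).sub (M.simpleIntegral_isSelfAdjoint s)) hε fun ψ => ?_
  rw [sub_apply, inner_sub_right, M.inner_integral hf hC, M.inner_simpleIntegral,
    ← Complex.ofReal_sub, Complex.ofReal_re]
  exact M.abs_integral_sub_le ψ
    (Integrable.of_bound hf.aestronglyMeasurable C (Filter.Eventually.of_forall hC))
    (SimpleFunc.integrable_of_isFiniteMeasure s) hs

theorem exists_tendsto_simpleIntegral (M : POVM X H) {f : X → ℝ} (hf : Measurable f) {C : ℝ}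
    (hC : ∀ x, |f x| ≤ C) :
    ∃ s : ℕ → SimpleFunc X ℝ, (∀ n x, |s n x| ≤ C + 1) ∧
      (∀ x, Filter.Tendsto (fun n => s n x) Filter.atTop (nhds (f x))) ∧
      Filter.Tendsto (fun n => M.simpleIntegral (s n)) Filter.atTop (nhds (M.integral f)) := by
  have hlim : Filter.Tendsto (fun n : ℕ => 1 / ((n : ℝ) + 1)) Filter.atTop (nhds 0) :=
    tendsto_one_div_add_atTop_nhds_zero_nat
  choose s hs using fun n : ℕ =>
    exists_simpleFunc_approx hf hC (Nat.one_div_pos_of_nat (α := ℝ) (n := n))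
  refine ⟨s, fun n x => ?_, fun x => ?_, ?_⟩
  -- The approximation error is at most `1 / (n + 1) ≤ 1`, whence the uniform bound `C + 1`.
  · have h1 : 1 / ((n : ℝ) + 1) ≤ 1 := by
      rw [div_le_one (by positivity)]
      linarith [n.cast_nonneg (α := ℝ)]
    have h2 := abs_le.1 ((hs n x).trans h1)
    have h3 := abs_le.1 (hC x)
    rw [abs_le]
    constructor <;> linarith [h2.1, h2.2, h3.1, h3.2]
  · rw [tendsto_iff_dist_tendsto_zero]
    refine squeeze_zero (fun _ => dist_nonneg) (fun n => ?_) hlim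
    rw [dist_comm, Real.dist_eq]
    exact hs n x
  · rw [tendsto_iff_norm_sub_tendsto_zero]
    exact squeeze_zero (fun _ => norm_nonneg _) (fun n =>
      M.norm_integral_sub_simpleIntegral_le hf hC (s n) (by positivity) (hs n)) hlim

end POVM

theorem norm_opTensor_sub_le (A A₀ : H →L[ℂ] H) (B B₀ : K →L[ℂ] K) :
    ‖opTensor A B - opTensor A₀ B₀‖ ≤ ‖A - A₀‖ * ‖B‖ + ‖A₀‖ * ‖B - B₀‖ := by
  have e : opTensor A B - opTensor A₀ B₀ = opTensor (A - A₀) B + opTensor A₀ (B - B₀) := by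
    rw [opTensor_sub_left, opTensor_sub_right, sub_add_sub_cancel]
  rw [e]
  exact (norm_add_le (opTensor (A - A₀) B) (opTensor A₀ (B - B₀))).trans
    (add_le_add (norm_opTensor_le (A - A₀) B) (norm_opTensor_le A₀ (B - B₀)))

theorem tendsto_norm_opTensor_sub {α : Type*} {l : Filter α} {A : α → H →L[ℂ] H}
    {B : α → K →L[ℂ] K} {A₀ : H →L[ℂ] H} {B₀ : K →L[ℂ] K} (hA : Filter.Tendsto A l (nhds A₀))
    (hB : Filter.Tendsto B l (nhds B₀)) :
    Filter.Tendsto (fun a => ‖opTensor (A a) (B a) - opTensor A₀ B₀‖) l (nhds 0) := by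
  have h : Filter.Tendsto (fun a => ‖A a - A₀‖ * ‖B a‖ + ‖A₀‖ * ‖B a - B₀‖) l (nhds 0) := by
    have := ((tendsto_iff_norm_sub_tendsto_zero.1 hA).mul hB.norm).add
      ((tendsto_iff_norm_sub_tendsto_zero.1 hB).const_mul ‖A₀‖)
    simpa only [zero_mul, mul_zero, add_zero] using this
  exact squeeze_zero (fun a => ContinuousLinearMap.opNorm_nonneg _)
    (fun a => norm_opTensor_sub_le _ _ _ _) h

theorem integral_mul_simpleFunc (μ : Measure (X × Y)) [IsFiniteMeasure μ] (s : SimpleFunc X ℝ)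
    (t : SimpleFunc Y ℝ) :
    ∫ p, s p.1 * t p.2 ∂μ =
      ∑ c ∈ s.range, ∑ d ∈ t.range, c * d * μ.real ((s ⁻¹' {c}) ×ˢ (t ⁻¹' {d})) := by
  have hind : ∀ p : X × Y, s p.1 * t p.2 = ∑ c ∈ s.range, ∑ d ∈ t.range,
      ((s ⁻¹' {c}) ×ˢ (t ⁻¹' {d})).indicator (fun _ => c * d) p := by
    intro p
    rw [Finset.sum_eq_single (s p.1), Finset.sum_eq_single (t p.2)]
    · simp
    · intro d _ hd
      simp [hd.symm]
    · intro h
      exact absurd (t.mem_range_self p.2) h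
    · intro c _ hc
      refine Finset.sum_eq_zero fun d _ => ?_
      simp [hc.symm]
    · intro h
      exact absurd (s.mem_range_self p.1) h
  have hm : ∀ c d, MeasurableSet ((s ⁻¹' {c}) ×ˢ (t ⁻¹' {d})) := fun c d =>
    (s.measurableSet_preimage _).prod (t.measurableSet_preimage _)
  have hi : ∀ c d, Integrable
      (((s ⁻¹' {c}) ×ˢ (t ⁻¹' {d})).indicator fun _ : X × Y => (c * d : ℝ)) μ := fun c d =>
    (integrable_const _).indicator (hm c d)
  simp only [hind]
  rw [integral_finsetSum _ fun c _ => integrable_finsetSum _ fun d _ => hi c d]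
  refine Finset.sum_congr rfl fun c _ => ?_
  rw [integral_finsetSum _ fun d _ => hi c d]
  refine Finset.sum_congr rfl fun d _ => ?_
  rw [integral_indicator_const _ (hm c d), smul_eq_mul, mul_comm]

/-- `tr[ρ (∫ f dM ⊗ ∫ g dN)] = ∫ f(x) g(y) tr[ρ (M(dx) ⊗ N(dy))]`. -/
theorem IsNuclear.trace_opTensor_integral {ρ : HTensor H K →L[ℂ] HTensor H K}
    {u v : ι → HTensor H K} (h : IsNuclear ρ u v) (M : POVM X H) (N : POVM Y K)
    (μ : Measure (X × Y)) [IsFiniteMeasure μ]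
    (hμ : ∀ D E, MeasurableSet D → MeasurableSet E →
      trace (ρ ∘L opTensor (M.effect D) (N.effect E)) = (μ.real (D ×ˢ E) : ℂ))
    {f : X → ℝ} {g : Y → ℝ} (hf : Measurable f) (hg : Measurable g) {C C' : ℝ}
    (hC : ∀ x, |f x| ≤ C) (hC' : ∀ y, |g y| ≤ C') :
    trace (ρ ∘L opTensor (M.integral f) (N.integral g)) =
      ((∫ p, f p.1 * g p.2 ∂μ : ℝ) : ℂ) := by
  have hst : ∀ (s : SimpleFunc X ℝ) (t : SimpleFunc Y ℝ),
      trace (ρ ∘L opTensor (M.simpleIntegral s) (N.simpleIntegral t)) =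
        ((∫ p, s p.1 * t p.2 ∂μ : ℝ) : ℂ) := by
    intro s t
    rw [integral_mul_simpleFunc, POVM.simpleIntegral, opTensor_sum_left, h.trace_comp_sum]
    push_cast
    refine Finset.sum_congr rfl fun c _ => ?_
    rw [POVM.simpleIntegral, opTensor_sum_right, h.trace_comp_sum, Finset.mul_sum]
    refine Finset.sum_congr rfl fun d _ => ?_
    rw [hμ _ _ (s.measurableSet_preimage _) (t.measurableSet_preimage _), mul_assoc]
  -- Passage to the limit: on the operator side by norm convergence and the nuclear bound on the
  -- trace, on the measure side by dominated convergence.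
  obtain ⟨s, hsb, hsl, hsi⟩ := M.exists_tendsto_simpleIntegral hf hC
  obtain ⟨t, htb, htl, hti⟩ := N.exists_tendsto_simpleIntegral hg hC'
  have h1 : Filter.Tendsto (fun n => trace (ρ ∘L opTensor (M.simpleIntegral (s n))
      (N.simpleIntegral (t n)))) Filter.atTop
      (nhds (trace (ρ ∘L opTensor (M.integral f) (N.integral g)))) := by
    have h2 := tendsto_norm_opTensor_sub hsi hti
    rw [tendsto_iff_norm_sub_tendsto_zero]
    refine squeeze_zero (fun _ => norm_nonneg _) (fun n => ?_)
      (by simpa using h2.mul_const (∑' i, (‖u i‖ ^ 2 + ‖v i‖ ^ 2) / 2))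
    rw [← h.trace_comp_sub]
    exact h.norm_trace_comp_le _
  simp only [hst] at h1
  refine tendsto_nhds_unique h1 ((Complex.continuous_ofReal.tendsto _).comp ?_)
  refine tendsto_integral_of_dominated_convergence (fun _ => (C + 1) * (C' + 1)) (fun n => ?_)
    (integrable_const _) (fun n => Filter.Eventually.of_forall fun p => ?_)
    (Filter.Eventually.of_forall fun p => (hsl p.1).mul (htl p.2))
  · exact (((s n).measurable.comp measurable_fst).mul
      ((t n).measurable.comp measurable_snd)).aestronglyMeasurable
  · rw [norm_mul]
    exact mul_le_mul (hsb n _) (htb n _) (norm_nonneg _) ((abs_nonneg _).trans (hsb n p.1))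

end Effects

/-! ### Tensor positivity tested on positive product operators. -/

section Positivity

variable {H₁ H₂ : Type*} [NormedAddCommGroup H₁] [InnerProductSpace ℂ H₁] [CompleteSpace H₁]
  [NormedAddCommGroup H₂] [InnerProductSpace ℂ H₂] [CompleteSpace H₂] {ι : Type*}

/-- `tr[R (A ⊗ B ⊗ C)]` is real and nonnegative for tensor-positive `R` and positive `A, B, C`. -/
theorem IsTensorPositive.trace_nonneg
    {R : HTensor H₁ (HTensor H₂ H₂) →L[ℂ] HTensor H₁ (HTensor H₂ H₂)} (hR : IsTensorPositive R)
    {u v : ι → HTensor H₁ (HTensor H₂ H₂)} (h : IsNuclear R u v)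
    {A : H₁ →L[ℂ] H₁} {B C : H₂ →L[ℂ] H₂} (hA : A.IsPositive) (hB : B.IsPositive)
    (hC : C.IsPositive) :
    0 ≤ (trace (R ∘L opTensor A (opTensor B C))).re ∧
      (trace (R ∘L opTensor A (opTensor B C))).im = 0 := by
  obtain ⟨a, ha, rfl⟩ := exists_adjoint_comp_self hA
  obtain ⟨b, hb, rfl⟩ := exists_adjoint_comp_self hB
  obtain ⟨c, hc, rfl⟩ := exists_adjoint_comp_self hC
  obtain ⟨d, hd⟩ := exists_hilbertBasis_htmul (basis H₂) (basis H₂)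
  obtain ⟨d', hd'⟩ := exists_hilbertBasis_htmul (basis H₁) d
  set S := opTensor a (opTensor b c) with hS
  have hSS : opTensor (a ∘L a) (opTensor (b ∘L b) (c ∘L c)) = S ∘L S := by
    rw [hS, opTensor_comp_opTensor, opTensor_comp_opTensor]
  have hSa : ContinuousLinearMap.adjoint S = S := by
    rw [hS, adjoint_opTensor, adjoint_opTensor, ha, hb, hc]
  rw [hSS]
  -- By cyclicity the trace is that of `S R S`. In a product basis `S` sends each basis vector to a
  -- product vector, the only kind on which `R` is known to be nonnegative.
  have hsum := h.hasSum_trace_comp_comp S S d'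
  have hterm : ∀ j, ⟪d' j, S (R (S (d' j)))⟫_ℂ =
      ⟪htmul (a (basis H₁ j.1)) (htmul (b (basis H₂ j.2.1)) (c (basis H₂ j.2.2))),
        R (htmul (a (basis H₁ j.1)) (htmul (b (basis H₂ j.2.1)) (c (basis H₂ j.2.2))))⟫_ℂ := by
    intro j
    rw [← ContinuousLinearMap.adjoint_inner_left, hSa, hd', hd, hS, opTensor_htmul, opTensor_htmul]
  simp only [hterm] at hsum
  refine ⟨(Complex.hasSum_re hsum).nonneg fun j => (hR.2 _ _ _).1, ?_⟩
  refine (Complex.hasSum_im hsum).unique ?_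
  simp only [(hR.2 _ _ _).2]
  exact hasSum_zero

end Positivity

end QuantumBell

end

/-! ### Extending separately countably additive functions of boxes to measures. -/

section Bimeasure

open Filter Set
open scoped Topology ENNReal

namespace QuantumBell

variable {X Y Z : Type*} [MeasurableSpace X] [MeasurableSpace Y] [MeasurableSpace Z]

theorem exists_measure_of_tsum {f : Set X → ℝ≥0∞} (h0 : f ∅ ≠ ∞)
    (hf : ∀ D : ℕ → Set X, (∀ n, MeasurableSet (D n)) → Pairwise (Function.onFun Disjoint D) →
      f (⋃ n, D n) = ∑' n, f (D n)) :
    ∃ μ : Measure X, ∀ D, MeasurableSet D → μ D = f D := by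
  have hemp : f ∅ = 0 := by
    by_contra hne
    -- The empty set is a disjoint union of infinitely many copies of itself, so a nonzero value
    -- there would be infinite.
    have h := hf (fun _ => ∅) (fun _ => MeasurableSet.empty) (fun _ _ _ => by simp [Function.onFun])
    rw [ENNReal.tsum_const_eq_top_of_ne_zero hne, iUnion_empty] at h
    exact h0 h
  exact ⟨Measure.ofMeasurable (fun D _ => f D) hemp fun D hD hdisj => hf D hD hdisj,
    fun D hD => Measure.ofMeasurable_apply D hD⟩

section Real

variable {m : Set ℝ → Measure Y} {c : Set Y → Measure ℝ} [IsFiniteMeasure (m univ)]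

/-- The families `m` and `c` are two views of one bimeasure; for fixed `E`, monotonicity in `D` is
that of the measure `c E`. -/
theorem bimeasure_mono {X : Type*} [MeasurableSpace X] {m : Set X → Measure Y}
    {c : Set Y → Measure X} (h : ∀ D E, MeasurableSet D → MeasurableSet E → m D E = c E D)
    {D D' : Set X} (hD : MeasurableSet D) (hD' : MeasurableSet D') (hDD' : D ⊆ D') :
    m D ≤ m D' :=
  Measure.le_iff.2 fun E hE => by
    rw [h D E hD hE, h D' E hD' hE]
    exact measure_mono hDD'

/-- The Radon–Nikodym density of `E ↦ m (-∞, q] E` with respect to `E ↦ m ℝ E`. -/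
noncomputable def bimeasureCDF (m : Set ℝ → Measure Y) (y : Y) (q : ℚ) : ℝ :=
  ((m (Iic (q : ℝ))).rnDeriv (m univ) y).toReal

theorem measurable_bimeasureCDF (m : Set ℝ → Measure Y) : Measurable (bimeasureCDF m) :=
  measurable_pi_iff.2 fun _ => (Measure.measurable_rnDeriv _ _).ennreal_toReal

theorem isFiniteMeasure_bimeasure (h : ∀ D E, MeasurableSet D → MeasurableSet E → m D E = c E D)
    {D : Set ℝ} (hD : MeasurableSet D) : IsFiniteMeasure (m D) :=
  isFiniteMeasure_of_le (m univ) (bimeasure_mono h hD .univ (subset_univ _))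

theorem isFiniteMeasure_bimeasure_right
    (h : ∀ D E, MeasurableSet D → MeasurableSet E → m D E = c E D)
    {E : Set Y} (hE : MeasurableSet E) : IsFiniteMeasure (c E) :=
  ⟨by rw [← h univ E .univ hE]; exact measure_lt_top _ _⟩

theorem setLIntegral_bimeasureCDF (h : ∀ D E, MeasurableSet D → MeasurableSet E → m D E = c E D)
    (q : ℚ) (E : Set Y) :
    ∫⁻ y in E, (m (Iic (q : ℝ))).rnDeriv (m univ) y ∂(m univ) = m (Iic (q : ℝ)) E := by
  have := isFiniteMeasure_bimeasure h (measurableSet_Iic (a := (q : ℝ)))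
  exact Measure.setLIntegral_rnDeriv
    (Measure.absolutelyContinuous_of_le
      (bimeasure_mono h measurableSet_Iic .univ (subset_univ _))) _

/-- Integrating the densities over any `E` gives back `m`, where the inequality is `bimeasure_mono`.
-/
theorem rnDeriv_Iic_le (h : ∀ D E, MeasurableSet D → MeasurableSet E → m D E = c E D) {D : Set ℝ}
    (hD : MeasurableSet D) (q : ℚ) (hq : Iic (q : ℝ) ⊆ D)
    [IsFiniteMeasure (m D)] :
    (m (Iic (q : ℝ))).rnDeriv (m univ) ≤ᵐ[m univ] (m D).rnDeriv (m univ) := by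
  refine ae_le_of_forall_setLIntegral_le_of_sigmaFinite (Measure.measurable_rnDeriv _ _)
    fun E _ _ => ?_
  rw [setLIntegral_bimeasureCDF h, Measure.setLIntegral_rnDeriv
    (Measure.absolutelyContinuous_of_le (bimeasure_mono h hD .univ (subset_univ _)))]
  exact bimeasure_mono h measurableSet_Iic hD hq E

theorem rnDeriv_Iic_le_one (h : ∀ D E, MeasurableSet D → MeasurableSet E → m D E = c E D) :
    ∀ᵐ y ∂(m univ), ∀ q : ℚ, (m (Iic (q : ℝ))).rnDeriv (m univ) y ≤ 1 := by
  rw [ae_all_iff]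
  intro q
  filter_upwards [rnDeriv_Iic_le h .univ q (subset_univ _), (m univ).rnDeriv_self] with y h1 h2
  rwa [h2] at h1

theorem bimeasureCDF_le_one (h : ∀ D E, MeasurableSet D → MeasurableSet E → m D E = c E D) :
    ∀ᵐ y ∂(m univ), ∀ q, bimeasureCDF m y q ≤ 1 := by
  filter_upwards [rnDeriv_Iic_le_one h] with y hy q
  exact ENNReal.toReal_le_of_le_ofReal zero_le_one (by simpa using hy q)

theorem monotone_bimeasureCDF (h : ∀ D E, MeasurableSet D → MeasurableSet E → m D E = c E D) :
    ∀ᵐ y ∂(m univ), Monotone (bimeasureCDF m y) := by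
  have hm : ∀ᵐ y ∂(m univ), ∀ q r : ℚ, q ≤ r →
      (m (Iic (q : ℝ))).rnDeriv (m univ) y ≤ (m (Iic (r : ℝ))).rnDeriv (m univ) y := by
    simp_rw [ae_all_iff]
    intro q r hqr
    have := isFiniteMeasure_bimeasure h (measurableSet_Iic (a := (r : ℝ)))
    exact rnDeriv_Iic_le h measurableSet_Iic q (Iic_subset_Iic.2 (mod_cast hqr))
  filter_upwards [hm, rnDeriv_Iic_le_one h] with y h1 h2 q r hqr
  exact ENNReal.toReal_mono ((h2 r).trans_lt ENNReal.one_lt_top).ne (h1 q r hqr)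

theorem integrable_bimeasureCDF (h : ∀ D E, MeasurableSet D → MeasurableSet E → m D E = c E D)
    (q : ℚ) : Integrable (fun y => bimeasureCDF m y q) (m univ) := by
  refine Integrable.of_bound
    (measurable_pi_iff.1 (measurable_bimeasureCDF m) q).aestronglyMeasurable 1 ?_
  filter_upwards [bimeasureCDF_le_one h] with y hy
  exact (Real.norm_of_nonneg ENNReal.toReal_nonneg).trans_le (hy q)

theorem setIntegral_bimeasureCDF (h : ∀ D E, MeasurableSet D → MeasurableSet E → m D E = c E D)
    (q : ℚ) {E : Set Y} (hE : MeasurableSet E) :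
    ∫ y in E, bimeasureCDF m y q ∂(m univ) = (c E).real (Iic (q : ℝ)) := by
  simp only [bimeasureCDF]
  rw [integral_toReal (Measure.measurable_rnDeriv _ _).aemeasurable,
    setLIntegral_bimeasureCDF h, h _ _ measurableSet_Iic hE, measureReal_def]
  refine ae_restrict_of_ae ?_
  filter_upwards [rnDeriv_Iic_le_one h] with y hy
  exact (hy q).trans_lt ENNReal.one_lt_top

theorem integral_bimeasureCDF (h : ∀ D E, MeasurableSet D → MeasurableSet E → m D E = c E D)
    (q : ℚ) : ∫ y, bimeasureCDF m y q ∂(m univ) = (c univ).real (Iic (q : ℝ)) := by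
  rw [← setIntegral_univ, setIntegral_bimeasureCDF h q .univ]

/-- A monotone sequence below its proposed limit converges to it almost everywhere once the
integrals converge, and these are values of the measure `c univ` on half-lines. The limit at `-∞`
and right continuity follow in the same way, with antitone sequences. -/
theorem tendsto_bimeasureCDF_atTop
    (h : ∀ D E, MeasurableSet D → MeasurableSet E → m D E = c E D) :
    ∀ᵐ y ∂(m univ), Tendsto (bimeasureCDF m y) atTop (𝓝 1) := by
  have := isFiniteMeasure_bimeasure_right h (MeasurableSet.univ (α := Y))
  have hn : ∀ᵐ y ∂(m univ), Tendsto (fun n : ℕ => bimeasureCDF m y n) atTop (𝓝 1) := by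
    refine tendsto_of_integral_tendsto_of_monotone (fun n => integrable_bimeasureCDF h n)
      (integrable_const _) ?_ ?_ ?_
    · simp only [integral_bimeasureCDF h, MeasureTheory.integral_const, smul_eq_mul, mul_one]
      rw [measureReal_def, h univ univ .univ .univ]
      refine (ENNReal.continuousAt_toReal (measure_ne_top _ _)).tendsto.comp ?_
      refine (tendsto_measure_Iic_atTop (c univ)).comp ?_
      simpa using tendsto_natCast_atTop_atTop (R := ℝ)
    · filter_upwards [monotone_bimeasureCDF h] with y hy using fun a b hab => hy (mod_cast hab)
    · filter_upwards [bimeasureCDF_le_one h] with y hy using fun n => hy n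
  filter_upwards [hn, monotone_bimeasureCDF h] with y h1 h2
  rw [tendsto_iff_tendsto_subseq_of_monotone h2 tendsto_natCast_atTop_atTop]
  exact h1

theorem tendsto_bimeasureCDF_atBot
    (h : ∀ D E, MeasurableSet D → MeasurableSet E → m D E = c E D) :
    ∀ᵐ y ∂(m univ), Tendsto (bimeasureCDF m y) atBot (𝓝 0) := by
  have := isFiniteMeasure_bimeasure_right h (MeasurableSet.univ (α := Y))
  have hn : ∀ᵐ y ∂(m univ), Tendsto (fun n : ℕ => bimeasureCDF m y (-n)) atTop (𝓝 0) := by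
    refine tendsto_of_integral_tendsto_of_antitone (fun n => integrable_bimeasureCDF h (-n))
      (integrable_const _) ?_ ?_ ?_
    · simp only [integral_bimeasureCDF h, MeasureTheory.integral_const, smul_eq_mul, mul_zero]
      refine (ENNReal.continuousAt_toReal ENNReal.zero_ne_top).tendsto.comp ?_
      have hI : ⋂ n : ℕ, Iic (-(n : ℝ)) = ∅ := by
        refine eq_empty_of_forall_notMem fun x hx => ?_
        obtain ⟨n, hn⟩ := exists_nat_gt (-x)
        linarith [mem_Iic.1 (mem_iInter.1 hx n)]
      have ht := tendsto_measure_iInter_atTop (μ := c univ) (s := fun n : ℕ => Iic (-(n : ℝ)))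
        (fun n => measurableSet_Iic.nullMeasurableSet)
        (fun a b hab => Iic_subset_Iic.2 (neg_le_neg (mod_cast hab))) ⟨0, measure_ne_top _ _⟩
      rw [hI, measure_empty] at ht
      simpa [Function.comp_def] using ht
    · filter_upwards [monotone_bimeasureCDF h] with y hy
      exact fun a b hab => hy (neg_le_neg (mod_cast hab))
    · exact Eventually.of_forall fun y n => ENNReal.toReal_nonneg
  filter_upwards [hn, monotone_bimeasureCDF h] with y h1 h2
  have h3 : Antitone fun q : ℚ => bimeasureCDF m y (-q) := fun a b hab => h2 (neg_le_neg hab)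
  exact tendsto_comp_neg_atTop_iff.1
    ((tendsto_iff_tendsto_subseq_of_antitone h3 tendsto_natCast_atTop_atTop).2 h1)

theorem iInf_bimeasureCDF (h : ∀ D E, MeasurableSet D → MeasurableSet E → m D E = c E D) :
    ∀ᵐ y ∂(m univ), ∀ q, ⨅ r : Ioi q, bimeasureCDF m y r = bimeasureCDF m y q := by
  have := isFiniteMeasure_bimeasure_right h (MeasurableSet.univ (α := Y))
  have hpos : ∀ n : ℕ, (0 : ℚ) < 1 / ((n : ℚ) + 1) := fun n => Nat.one_div_pos_of_nat
  rw [ae_all_iff]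
  intro q
  -- One sequence decreasing to `q` suffices: by monotonicity its limit bounds the infimum from
  -- above.
  have hn : ∀ᵐ y ∂(m univ), Tendsto (fun n : ℕ => bimeasureCDF m y (q + 1 / ((n : ℚ) + 1))) atTop
      (𝓝 (bimeasureCDF m y q)) := by
    refine tendsto_of_integral_tendsto_of_antitone
      (fun n => integrable_bimeasureCDF h (q + 1 / ((n : ℚ) + 1)))
      (integrable_bimeasureCDF h q) ?_ ?_ ?_
    · simp only [integral_bimeasureCDF h]
      refine (ENNReal.continuousAt_toReal (measure_ne_top _ _)).tendsto.comp ?_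
      have hI : Iic (q : ℝ) = ⋂ r > (q : ℝ), Iic r := by
        ext x
        simp only [mem_Iic, mem_iInter]
        exact ⟨fun hx r hr => hx.trans hr.le, fun hx => le_of_forall_gt_imp_ge_of_dense hx⟩
      have ht := tendsto_measure_biInter_gt (μ := c univ) (s := fun r : ℝ => Iic r) (a := (q : ℝ))
        (fun r _ => measurableSet_Iic.nullMeasurableSet)
        (fun i j _ hij => Iic_subset_Iic.2 hij) ⟨q + 1, by simp, measure_ne_top _ _⟩
      rw [← hI] at ht
      refine ht.comp (tendsto_nhdsWithin_iff.2 ⟨?_, Eventually.of_forall fun n => ?_⟩)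
      · have := (tendsto_one_div_add_atTop_nhds_zero_nat (𝕜 := ℝ)).const_add (q : ℝ)
        simpa using this
      · have := hpos n
        rw [mem_Ioi]
        exact_mod_cast lt_add_of_pos_right q this
    · filter_upwards [monotone_bimeasureCDF h] with y hy
      exact fun a b hab => hy (add_le_add_right (Nat.one_div_le_one_div hab) q)
    · filter_upwards [monotone_bimeasureCDF h] with y hy
      exact fun n => hy (le_add_of_nonneg_right (hpos n).le)
  filter_upwards [hn, monotone_bimeasureCDF h] with y h1 h2
  have : Nonempty (Ioi q) := ⟨⟨q + 1, by simp⟩⟩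
  have hb : BddBelow (range fun r : Ioi q => bimeasureCDF m y r) :=
    ⟨0, by rintro _ ⟨r, rfl⟩; exact ENNReal.toReal_nonneg⟩
  refine le_antisymm (ge_of_tendsto' h1 fun n => ?_) (le_ciInf fun r => h2 (le_of_lt r.2))
  exact ciInf_le hb ⟨q + 1 / ((n : ℚ) + 1), lt_add_of_pos_right q (hpos n)⟩

theorem isRatStieltjesPoint_bimeasureCDF
    (h : ∀ D E, MeasurableSet D → MeasurableSet E → m D E = c E D) :
    ∀ᵐ y ∂(m univ), IsRatStieltjesPoint (bimeasureCDF m) y := by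
  filter_upwards [monotone_bimeasureCDF h, tendsto_bimeasureCDF_atTop h,
    tendsto_bimeasureCDF_atBot h, iInf_bimeasureCDF h] with y h1 h2 h3 h4
  exact ⟨h1, h2, h3, h4⟩

/-- The rational densities are almost everywhere distribution functions, so they define a Markov
kernel `κ` to `ℝ`; the measure is `m univ ⊗ₘ κ`. -/
theorem exists_measure_prod_real (h : ∀ D E, MeasurableSet D → MeasurableSet E → m D E = c E D) :
    ∃ μ : Measure (Y × ℝ), ∀ D E, MeasurableSet D → MeasurableSet E → μ (E ×ˢ D) = m D E := by
  have hg := measurable_bimeasureCDF m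
  let κ : Kernel Y ℝ := ⟨fun y => (stieltjesOfMeasurableRat (bimeasureCDF m) hg y).measure,
    measurable_measure_stieltjesOfMeasurableRat hg⟩
  have hκ : IsMarkovKernel κ :=
    ⟨fun y => ⟨measure_stieltjesOfMeasurableRat_univ hg y⟩⟩
  have hIic : ∀ (q : ℚ) (E : Set Y), MeasurableSet E →
      (m univ ⊗ₘ κ) (E ×ˢ Iic (q : ℝ)) = c E (Iic (q : ℝ)) := by
    intro q E hE
    rw [Measure.compProd_apply_prod hE measurableSet_Iic, ← h _ _ measurableSet_Iic hE,
      ← setLIntegral_bimeasureCDF h q E]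
    refine lintegral_congr_ae (ae_restrict_of_ae ?_)
    filter_upwards [isRatStieltjesPoint_bimeasureCDF h, rnDeriv_Iic_le_one h] with y h1 h2
    change (stieltjesOfMeasurableRat (bimeasureCDF m) hg y).measure _ = _
    rw [measure_stieltjesOfMeasurableRat_Iic, stieltjesOfMeasurableRat_eq,
      toRatCDF_of_isRatStieltjesPoint h1, bimeasureCDF,
      ENNReal.ofReal_toReal ((h2 q).trans_lt ENNReal.one_lt_top).ne]
  refine ⟨m univ ⊗ₘ κ, fun D E hD hE => ?_⟩
  rw [h D E hD hE]
  have := isFiniteMeasure_bimeasure_right h hE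
  have happ : ∀ D, MeasurableSet D →
      ((m univ ⊗ₘ κ).restrict (E ×ˢ univ)).snd D = (m univ ⊗ₘ κ) (E ×ˢ D) := by
    intro D hD
    rw [Measure.snd_apply hD, Measure.restrict_apply (measurable_snd hD)]
    congr 1
    ext p
    simp [and_comm]
  -- For fixed `E` both sides are finite measures on `ℝ` with the same total mass, agreeing on the
  -- π-system of rational half-lines.
  have heq : ((m univ ⊗ₘ κ).restrict (E ×ˢ univ)).snd = c E := by
    refine ext_of_generate_finite _ Real.borel_eq_generateFrom_Iic_rat Real.isPiSystem_Iic_rat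
      ?_ ?_
    · intro s hs
      simp only [mem_iUnion, mem_singleton_iff] at hs
      obtain ⟨q, rfl⟩ := hs
      rw [happ _ measurableSet_Iic, hIic q E hE]
    · rw [happ _ .univ, Measure.compProd_apply_prod hE .univ, ← h _ _ .univ hE]
      simp
  rw [← happ D hD, heq]

end Real

/-- A family of measures `m D` on `Y`, countably additive in `D`, comes from a measure on
`Y × X`. -/
theorem exists_measure_prod [StandardBorelSpace X] {m : Set X → Measure Y} {c : Set Y → Measure X}
    [IsFiniteMeasure (m univ)] (h : ∀ D E, MeasurableSet D → MeasurableSet E → m D E = c E D) :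
    ∃ μ : Measure (Y × X), IsFiniteMeasure μ ∧
      ∀ D E, MeasurableSet D → MeasurableSet E → μ (E ×ˢ D) = m D E := by
  have he := measurableEmbedding_embeddingReal X
  have hfin : IsFiniteMeasure (m (embeddingReal X ⁻¹' univ)) := by
    rw [preimage_univ]; infer_instance
  -- A measurable embedding of `X` into `ℝ` reduces to the real case; the result is pulled back
  -- along it.
  obtain ⟨μ, hμ⟩ := exists_measure_prod_real (m := fun D => m (embeddingReal X ⁻¹' D))
    (c := fun E => (c E).map (embeddingReal X)) fun D E hD hE => by
      rw [h _ E (he.measurable hD) hE, Measure.map_apply he.measurable hD]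
  have hp : MeasurableEmbedding (Prod.map id (embeddingReal X) : Y × X → Y × ℝ) :=
    MeasurableEmbedding.id.prodMap he
  have happ : ∀ D E, MeasurableSet D → MeasurableSet E →
      (μ.comap (Prod.map id (embeddingReal X))) (E ×ˢ D) = m D E := by
    intro D E hD hE
    rw [hp.comap_apply, prodMap_image_prod, image_id, hμ _ _ (he.measurableSet_image.2 hD) hE,
      preimage_image_eq _ he.injective]
  refine ⟨_, ⟨?_⟩, happ⟩
  rw [← univ_prod_univ, happ _ _ .univ .univ]
  exact measure_lt_top _ _

/-- A positive set function on boxes, countably additive in each of the three variables, extends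
to a measure. -/
theorem exists_measure_prod₃ [StandardBorelSpace X] [StandardBorelSpace Z]
    {t : Set X → Set Y → Set Z → ℝ≥0∞} (hfin : ∀ D E F, t D E F ≠ ∞)
    (hX : ∀ D : ℕ → Set X, (∀ n, MeasurableSet (D n)) → Pairwise (Function.onFun Disjoint D) →
      ∀ E F, MeasurableSet E → MeasurableSet F → t (⋃ n, D n) E F = ∑' n, t (D n) E F)
    (hY : ∀ E : ℕ → Set Y, (∀ n, MeasurableSet (E n)) → Pairwise (Function.onFun Disjoint E) →
      ∀ D F, MeasurableSet D → MeasurableSet F → t D (⋃ n, E n) F = ∑' n, t D (E n) F)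
    (hZ : ∀ F : ℕ → Set Z, (∀ n, MeasurableSet (F n)) → Pairwise (Function.onFun Disjoint F) →
      ∀ D E, MeasurableSet D → MeasurableSet E → t D E (⋃ n, F n) = ∑' n, t D E (F n)) :
    ∃ μ : Measure ((Y × Z) × X), IsFiniteMeasure μ ∧
      ∀ D E F, MeasurableSet D → MeasurableSet E → MeasurableSet F →
        μ ((E ×ˢ F) ×ˢ D) = t D E F := by
  -- Two-stage gluing: `Y` with `Z` for each fixed `D`, then the resulting measures on `Y × Z` with
  -- `X`. Non-measurable sets receive the value `0`, since `exists_measure_prod` takes families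
  -- indexed by all sets.
  have h1 : ∀ D : {D : Set X // MeasurableSet D}, ∃ μ : Measure (Y × Z), IsFiniteMeasure μ ∧
      ∀ E F, MeasurableSet E → MeasurableSet F → μ (E ×ˢ F) = t D E F := by
    rintro ⟨D, hD⟩
    have hm : ∀ F : {F : Set Z // MeasurableSet F}, ∃ μ : Measure Y, ∀ E, MeasurableSet E →
        μ E = t D E F := fun F =>
      exists_measure_of_tsum (hfin _ _ _) fun E hE hdisj => hY E hE hdisj D F hD F.2
    have hc : ∀ E : {E : Set Y // MeasurableSet E}, ∃ μ : Measure Z, ∀ F, MeasurableSet F →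
        μ F = t D E F := fun E =>
      exists_measure_of_tsum (hfin _ _ _) fun F hF hdisj => hZ F hF hdisj D E hD E.2
    choose m hm using hm
    choose c hc using hc
    classical
    have : IsFiniteMeasure (if hF : MeasurableSet (univ : Set Z) then m ⟨univ, hF⟩ else 0) := by
      rw [dif_pos .univ]
      exact ⟨by rw [hm _ _ .univ]; exact (hfin _ _ _).lt_top⟩
    obtain ⟨μ, hμ, hμ'⟩ := exists_measure_prod
      (m := fun F : Set Z => if hF : MeasurableSet F then m ⟨F, hF⟩ else 0)
      (c := fun E : Set Y => if hE : MeasurableSet E then c ⟨E, hE⟩ else 0) fun F E hF hE => by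
        rw [dif_pos hF, dif_pos hE, hm _ _ hE, hc _ _ hF]
    refine ⟨μ, hμ, fun E F hE hF => ?_⟩
    rw [hμ' F E hF hE, dif_pos hF, hm _ _ hE]
  choose m hmf hm using h1
  -- Additivity in `D` is given only on boxes `E ×ˢ F`; uniqueness of finite measures with given
  -- values on boxes extends it to all measurable sets of `Y × Z`.
  have hadd : ∀ (D : ℕ → Set X) (hD : ∀ n, MeasurableSet (D n)),
      Pairwise (Function.onFun Disjoint D) →
      m ⟨⋃ n, D n, .iUnion hD⟩ = Measure.sum fun n => m ⟨D n, hD n⟩ := by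
    intro D hD hdisj
    refine Measure.ext_prod fun {E F} hE hF => ?_
    rw [Measure.sum_apply _ (hE.prod hF), hm _ _ _ hE hF, hX D hD hdisj E F hE hF]
    exact tsum_congr fun n => (hm ⟨D n, hD n⟩ _ _ hE hF).symm
  classical
  have hc : ∀ G : {G : Set (Y × Z) // MeasurableSet G}, ∃ μ : Measure X, ∀ D, MeasurableSet D →
      μ D = (if hD : MeasurableSet D then m ⟨D, hD⟩ else 0 : Measure (Y × Z)) G := by
    rintro ⟨G, hG⟩
    refine exists_measure_of_tsum ?_ fun D hD hdisj => ?_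
    · rw [dif_pos .empty]
      exact measure_ne_top _ _
    · rw [dif_pos (MeasurableSet.iUnion hD), hadd D hD hdisj, Measure.sum_apply _ hG]
      exact tsum_congr fun n => by rw [dif_pos (hD n)]
  choose c hc using hc
  have : IsFiniteMeasure (if hD : MeasurableSet (univ : Set X) then m ⟨univ, hD⟩ else 0) := by
    rw [dif_pos .univ]
    infer_instance
  obtain ⟨μ, hμ, hμ'⟩ := exists_measure_prod
    (m := fun D : Set X => if hD : MeasurableSet D then m ⟨D, hD⟩ else 0)
    (c := fun G : Set (Y × Z) => if hG : MeasurableSet G then c ⟨G, hG⟩ else 0)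
    fun D G hD hG => by rw [dif_pos hG, hc ⟨G, hG⟩ D hD]
  refine ⟨μ, hμ, fun D E F hD hE hF => ?_⟩
  rw [hμ' D _ hD (hE.prod hF), dif_pos hD, hm _ _ _ hE hF]

end QuantumBell

end Bimeasure

noncomputable section

namespace QuantumBell

/-! ### Partial traces of the source operator and its trivariate measure. -/

section Source

variable {H₁ H₂ : Type*} [NormedAddCommGroup H₁] [InnerProductSpace ℂ H₁] [CompleteSpace H₁]
  [NormedAddCommGroup H₂] [InnerProductSpace ℂ H₂] [CompleteSpace H₂] {ι : Type*}
  {R : HTensor H₁ (HTensor H₂ H₂) →L[ℂ] HTensor H₁ (HTensor H₂ H₂)}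
  {u v : ι → HTensor H₁ (HTensor H₂ H₂)}

/-- The duality `trace_tsum_adjoint_comp`, as are its two companions: an operator acting as the
identity in the traced slot intertwines with insertion there. -/
theorem IsNuclear.trace_partialTrace₁ (h : IsNuclear R u v)
    (T : HTensor H₂ H₂ →L[ℂ] HTensor H₂ H₂) :
    trace (partialTrace₁ R ∘L T) = trace (R ∘L opTensor 1 T) :=
  h.trace_tsum_adjoint_comp isParseval_insertLeft fun k =>
    ContinuousLinearMap.ext fun x => by simp [insertLeft_apply, opTensor_htmul]

theorem IsNuclear.trace_partialTrace₂ (h : IsNuclear R u v) (A : H₁ →L[ℂ] H₁)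
    (B : H₂ →L[ℂ] H₂) :
    trace (partialTrace₂ R ∘L opTensor A B) = trace (R ∘L opTensor A (opTensor 1 B)) :=
  h.trace_tsum_adjoint_comp isParseval_opTensor_insertLeft fun k =>
    ext_htmul fun x y => by simp [insertLeft_apply, opTensor_htmul]

theorem IsNuclear.trace_partialTrace₃ (h : IsNuclear R u v) (A : H₁ →L[ℂ] H₁)
    (B : H₂ →L[ℂ] H₂) :
    trace (partialTrace₃ R ∘L opTensor A B) = trace (R ∘L opTensor A (opTensor B 1)) :=
  h.trace_tsum_adjoint_comp isParseval_opTensor_insertRight fun k =>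
    ext_htmul fun x y => by simp [insertRight_apply, opTensor_htmul]

variable {X Y Z : Type*} [MeasurableSpace X] [MeasurableSpace Y] [MeasurableSpace Z]

/-- `tr[R (M(dx) ⊗ N(dy) ⊗ N'(dz))]` is a measure for tensor-positive `R`. -/
theorem IsTensorPositive.exists_measure [StandardBorelSpace X] [StandardBorelSpace Z]
    (hR : IsTensorPositive R) (h : IsNuclear R u v) (M : POVM X H₁) (N : POVM Y H₂)
    (N' : POVM Z H₂) :
    ∃ μ : Measure ((Y × Z) × X), IsFiniteMeasure μ ∧
      ∀ D E F, MeasurableSet D → MeasurableSet E → MeasurableSet F →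
        trace (R ∘L opTensor (M.effect D) (opTensor (N.effect E) (N'.effect F))) =
          (μ.real ((E ×ˢ F) ×ˢ D) : ℂ) := by
  set T : Set X → Set Y → Set Z → ℂ := fun D E F =>
    trace (R ∘L opTensor (M.effect D) (opTensor (N.effect E) (N'.effect F))) with hT
  have hpos : ∀ D E F, MeasurableSet D → MeasurableSet E → MeasurableSet F →
      0 ≤ (T D E F).re ∧ (T D E F).im = 0 := fun D E F hD hE hF =>
    hR.trace_nonneg h (M.isPositive D hD) (N.isPositive E hE) (N'.isPositive F hF)
  -- In each of the three forms, one slot is isolated as an effect of an amplified POV measure and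
  -- the other two go into the fixed factor of `hasSum_trace`.
  have hTX : ∀ D E F, T D E F =
      trace (R ∘L opTensor 1 (opTensor (N.effect E) (N'.effect F)) ∘L
        (M.ampRight (HTensor H₂ H₂)).effect D) := fun D E F => by
    simp only [hT, POVM.ampRight_effect, opTensor_comp_opTensor]
    rfl
  have hTY : ∀ D E F, T D E F =
      trace (R ∘L opTensor (M.effect D) (opTensor 1 (N'.effect F)) ∘L
        ((N.ampRight H₂).ampLeft H₁).effect E) := fun D E F => by
    simp only [hT, POVM.ampRight_effect, POVM.ampLeft_effect, opTensor_comp_opTensor]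
    rfl
  have hTZ : ∀ D E F, T D E F =
      trace (R ∘L opTensor (M.effect D) (opTensor (N.effect E) 1) ∘L
        ((N'.ampLeft H₂).ampLeft H₁).effect F) := fun D E F => by
    simp only [hT, POVM.ampLeft_effect, opTensor_comp_opTensor]
    rfl
  have hsum : ∀ {f : ℕ → ℂ} {a : ℂ}, HasSum f a → (∀ n, 0 ≤ (f n).re) →
      ENNReal.ofReal a.re = ∑' n, ENNReal.ofReal (f n).re := fun hf hn => by
    rw [← (Complex.hasSum_re hf).tsum_eq]
    exact ENNReal.ofReal_tsum_of_nonneg hn (Complex.hasSum_re hf).summable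
  obtain ⟨μ, hμ, hμ'⟩ := exists_measure_prod₃ (t := fun D E F => ENNReal.ofReal (T D E F).re)
    (fun _ _ _ => ENNReal.ofReal_ne_top)
    (fun D hD hdisj E F hE hF => hsum (by
      simp only [hTX]
      exact (M.ampRight (HTensor H₂ H₂)).hasSum_trace h _ hD hdisj)
      fun n => (hpos _ _ _ (hD n) hE hF).1)
    (fun E hE hdisj D F hD hF => hsum (by
      simp only [hTY]
      exact ((N.ampRight H₂).ampLeft H₁).hasSum_trace h _ hE hdisj)
      fun n => (hpos _ _ _ hD (hE n) hF).1)
    (fun F hF hdisj D E hD hE => hsum (by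
      simp only [hTZ]
      exact ((N'.ampLeft H₂).ampLeft H₁).hasSum_trace h _ hF hdisj)
      fun n => (hpos _ _ _ hD hE (hF n)).1)
  refine ⟨μ, hμ, fun D E F hD hE hF => ?_⟩
  have hp := hpos D E F hD hE hF
  rw [measureReal_def, hμ' D E F hD hE hF, ENNReal.toReal_ofReal hp.1]
  exact Complex.ext rfl (by simpa using hp.2)

end Source

/-! ### Joint distributions and the model built from Bob's pair. -/

section LHV

variable {Λ : Set ℝ} {H₁ H₂ : Type*}
  [NormedAddCommGroup H₁] [InnerProductSpace ℂ H₁] [CompleteSpace H₁]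
  [NormedAddCommGroup H₂] [InnerProductSpace ℂ H₂] [CompleteSpace H₂]

theorem IsJointDistribution.unique {ρ : HTensor H₁ H₂ →L[ℂ] HTensor H₁ H₂} {M : POVM Λ H₁}
    {N : POVM Λ H₂} {P Q : Measure (Λ × Λ)} (hP : IsJointDistribution ρ M N P)
    (hQ : IsJointDistribution ρ M N Q) : P = Q := by
  have := hP.1
  have := hQ.1
  refine Measure.ext_prod fun {D E} hD hE => ?_
  have h := (hP.2 D E hD hE).symm.trans (hQ.2 D E hD hE)
  rw [Complex.ofReal_inj, measureReal_def, measureReal_def] at h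
  exact (ENNReal.toReal_eq_toReal_iff' (measure_ne_top _ _) (measure_ne_top _ _)).1 h

/-- By uniqueness, the choice in `jointDistribution` is identified as soon as one candidate is
exhibited. -/
theorem IsJointDistribution.jointDistribution_eq {ρ : HTensor H₁ H₂ →L[ℂ] HTensor H₁ H₂}
    {M : POVM Λ H₁} {N : POVM Λ H₂} {P : Measure (Λ × Λ)} (hP : IsJointDistribution ρ M N P) :
    jointDistribution ρ M N = P := by
  have h : ∃ P, IsJointDistribution ρ M N P := ⟨P, hP⟩
  rw [jointDistribution, dif_pos h]
  exact h.choose_spec.unique hP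

/-- When one outcome is a function of the hidden variable, averaging the product kernel is just an
image of the joint law of hidden variable and other outcome. -/
theorem bind_prod_deterministic {Ω S T : Type*} [MeasurableSpace Ω] [MeasurableSpace S]
    [MeasurableSpace T] (ν : Measure Ω) [IsFiniteMeasure ν] (κ : Kernel Ω S) [IsMarkovKernel κ]
    {g : Ω → T} (hg : Measurable g) :
    ν.bind (κ ×ₖ Kernel.deterministic g hg) = (ν ⊗ₘ κ).map fun q => (q.2, g q.1) := by
  have hm : Measurable fun q : Ω × S => (q.2, g q.1) := by fun_prop
  symm
  refine Measure.ext_prod fun {D E} hD hE => ?_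
  have hpre : (fun q : Ω × S => (q.2, g q.1)) ⁻¹' (D ×ˢ E) = (g ⁻¹' E) ×ˢ D := by
    ext q
    simp [and_comm]
  rw [Measure.map_apply hm (hD.prod hE), hpre, Measure.compProd_apply_prod (hg hE) hD,
    Measure.bind_apply (hD.prod hE) (Kernel.aemeasurable _), ← lintegral_indicator (hg hE)]
  refine lintegral_congr fun p => ?_
  rw [Kernel.prod_apply, Measure.prod_prod, Kernel.deterministic_apply' hg _ hE]
  by_cases hp : g p ∈ E <;> simp [hp]

/-- The outcome of Bob's `k`-th measurement, given the outcomes of both. -/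
def bobOutcome (k : Fin 2) (p : Λ × Λ) : Λ := if k = 0 then p.1 else p.2

theorem measurable_bobOutcome (k : Fin 2) : Measurable (bobOutcome (Λ := Λ) k) := by
  unfold bobOutcome
  split_ifs
  · exact measurable_fst
  · exact measurable_snd

/-- The model whose hidden variable is the pair of Bob's outcomes; Alice's kernels are the
conditional distributions of her outcomes. -/
def LHVModel.ofMeasures [StandardBorelSpace Λ] [Nonempty Λ] (ν : Measure (Λ × Λ))
    [IsProbabilityMeasure ν] (μ : Fin 2 → Measure ((Λ × Λ) × Λ)) [∀ i, IsFiniteMeasure (μ i)] :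
    LHVModel Λ where
  Ω := Λ × Λ
  ν := ν
  alice i := (μ i).condKernel
  bob k := Kernel.deterministic (bobOutcome k) (measurable_bobOutcome k)

section

variable [StandardBorelSpace Λ] [Nonempty Λ] {ν : Measure (Λ × Λ)} [IsProbabilityMeasure ν]
  {μ : Fin 2 → Measure ((Λ × Λ) × Λ)} [∀ i, IsFiniteMeasure (μ i)]

/-- The common first marginal lets one `ν` serve both settings: `ν` with Alice's kernel `i`
recomposes `μ i`. -/
theorem LHVModel.ofMeasures_bind (hμ : ∀ i, (μ i).fst = ν) (i k : Fin 2) :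
    (ofMeasures ν μ).ν.bind ((ofMeasures ν μ).alice i ×ₖ (ofMeasures ν μ).bob k) =
      (μ i).map fun q => (q.2, bobOutcome k q.1) := by
  refine (bind_prod_deterministic ν (μ i).condKernel (measurable_bobOutcome k)).trans ?_
  conv_lhs => rw [← hμ i, (μ i).disintegrate (μ i).condKernel]

/-- Bob's two deterministic outcomes together reproduce the hidden variable, so only Alice's
disintegration for setting `1` has to be undone. -/
theorem LHVModel.ofMeasures_tripleDistribution (hμ : ∀ i, (μ i).fst = ν) :
    (ofMeasures ν μ).tripleDistribution = (μ 1).map Prod.swap := by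
  have h : (ofMeasures ν μ).bob 0 ×ₖ (ofMeasures ν μ).bob 1 =
      Kernel.deterministic (id : Λ × Λ → Λ × Λ) measurable_id :=
    Kernel.deterministic_prod_deterministic (measurable_bobOutcome 0) (measurable_bobOutcome 1)
  rw [tripleDistribution, h]
  refine (bind_prod_deterministic ν (μ 1).condKernel measurable_id).trans ?_
  conv_lhs => rw [← hμ 1, (μ 1).disintegrate (μ 1).condKernel]
  rfl

end

/-- The two signs are `(1 - x) * (1 + y) ≥ 0` and `(1 + x) * (1 - y) ≥ 0`. -/
theorem abs_sub_le_one_sub_mul {x y : ℝ} (hx : |x| ≤ 1) (hy : |y| ≤ 1) : |x - y| ≤ 1 - x * y := by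
  rw [abs_le] at *
  constructor <;> nlinarith

end LHV

end QuantumBell

end

/-! ### The local hidden variable model and the original Bell inequality. -/

theorem theorem2 {H₁ H₂ : Type*}
    [NormedAddCommGroup H₁] [InnerProductSpace ℂ H₁] [CompleteSpace H₁]
    [TopologicalSpace.SeparableSpace H₁]
    [NormedAddCommGroup H₂] [InnerProductSpace ℂ H₂] [CompleteSpace H₂]
    [TopologicalSpace.SeparableSpace H₂]
    (ρ : HTensor H₁ H₂ →L[ℂ] HTensor H₁ H₂) (hρ : IsDensityOperator ρ)
    (R : HTensor H₁ (HTensor H₂ H₂) →L[ℂ] HTensor H₁ (HTensor H₂ H₂))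
    (hR : IsSourceOperator R ρ) (hRpos : IsTensorPositive R)
    (Λ : Set ℝ) (hΛ : MeasurableSet Λ) (hΛ_sub : Λ ⊆ Set.Icc (-1) 1)
    (M₁ : Fin 2 → POVM Λ H₁) (M₂ : Fin 2 → POVM Λ H₂)
    (P : Fin 2 → Fin 2 → Measure (Λ × Λ))
    (hP : ∀ i k, P i k = jointDistribution ρ (M₁ i) (M₂ k))
    (A : Fin 2 → H₁ →L[ℂ] H₁) (hA : ∀ i, A i = (M₁ i).average)
    (B : Fin 2 → H₂ →L[ℂ] H₂) (hB : ∀ k, B k = (M₂ k).average) :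
    (∀ i k, IsJointDistribution ρ (M₁ i) (M₂ k) (P i k) ∧
      ((correlation (P i k) : ℝ) : ℂ) = trace (ρ ∘L opTensor (A i) (B k))) ∧
    (∃ m : LHVModel Λ, m.Reproduces P) ∧
    ∀ s : ℝ, s = 1 ∨ s = -1 →
      0 ≤ (trace (partialTrace₁ R ∘L opTensor (B 0) (B 1))).re -
        s * (trace (ρ ∘L opTensor (A 1) (B 1))).re →
      (∃ m : LHVModel Λ, m.Reproduces P ∧ m.IsConditional s) ∧
      |correlation (P 0 0) - correlation (P 0 1)| ≤ 1 - s * correlation (P 1 1) ∧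
      |(trace (ρ ∘L opTensor (A 0) (B 0))).re - (trace (ρ ∘L opTensor (A 0) (B 1))).re| ≤
        1 - s * (trace (ρ ∘L opTensor (A 1) (B 1))).re := by
  obtain ⟨u, v, hN⟩ := exists_isNuclear hR.isSelfAdjoint hR.isTraceClass
  obtain ⟨u', v', hNρ⟩ := exists_isNuclear hρ.isPositive.isSelfAdjoint hρ.isTraceClass
  have hNσ := hN.isNuclear_tsum_adjoint_comp (isParseval_insertLeft (E := H₁) (F := HTensor H₂ H₂))
  have : StandardBorelSpace Λ := hΛ.standardBorel
  have hbd : ∀ x : Λ, |(x : ℝ)| ≤ 1 := fun x => abs_le.2 (hΛ_sub x.2)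
  have hbd2 : ∀ x y : Λ, |(x : ℝ) * y| ≤ 1 := fun x y => by
    rw [abs_mul]
    exact mul_le_one₀ (hbd x) (abs_nonneg _) (hbd y)
  have h2 : ∀ (A : H₁ →L[ℂ] H₁) (B : H₂ →L[ℂ] H₂),
      trace (R ∘L opTensor A (opTensor 1 B)) = trace (ρ ∘L opTensor A B) := fun A B => by
    rw [← hN.trace_partialTrace₂, hR.partialTrace₂_eq]
  have h3 : ∀ (A : H₁ →L[ℂ] H₁) (B : H₂ →L[ℂ] H₂),
      trace (R ∘L opTensor A (opTensor B 1)) = trace (ρ ∘L opTensor A B) := fun A B => by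
    rw [← hN.trace_partialTrace₃, hR.partialTrace₃_eq]
  choose μ hμf hμ using fun i => hRpos.exists_measure hN (M₁ i) (M₂ 0) (M₂ 1)
  have hone : ∀ i, IsProbabilityMeasure (μ i) := fun i => by
    have h := hμ i Set.univ Set.univ Set.univ .univ .univ .univ
    rw [POVM.effect_univ, POVM.effect_univ, POVM.effect_univ, h2, opTensor_one_one,
      Set.univ_prod_univ, Set.univ_prod_univ] at h
    have h' : trace (ρ ∘L (1 : HTensor H₁ H₂ →L[ℂ] HTensor H₁ H₂)) = 1 := hρ.trace_eq_one
    rw [h', eq_comm, Complex.ofReal_eq_one, measureReal_def] at h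
    exact ⟨(ENNReal.toReal_eq_one_iff _).1 h⟩
  -- A probability measure lives on a nonempty space; `condKernel` needs this.
  have hne : Nonempty Λ := (((μ 0).nonempty_of_neZero).map Prod.snd)
  set ν := (μ 0).fst with hν
  have hνreal : ∀ i E F, MeasurableSet E → MeasurableSet F →
      trace (R ∘L opTensor 1 (opTensor ((M₂ 0).effect E) ((M₂ 1).effect F))) =
        ((μ i).fst.real (E ×ˢ F) : ℂ) := fun i E F hE hF => by
    rw [← (M₁ i).effect_univ, hμ i _ E F .univ hE hF, measureReal_def, measureReal_def,
      Measure.fst_apply (hE.prod hF), Set.prod_univ]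
  -- Summing over Alice's outcomes replaces her effect by `1`, so Bob's pair does not see her
  -- setting.
  have hfst : ∀ i, (μ i).fst = ν := fun i => by
    refine Measure.ext_prod fun {E F} hE hF => ?_
    have h := (hνreal i E F hE hF).symm.trans (hνreal 0 E F hE hF)
    rw [Complex.ofReal_inj, measureReal_def, measureReal_def] at h
    exact (ENNReal.toReal_eq_toReal_iff' (measure_ne_top _ _) (measure_ne_top _ _)).1 h
  have hmeas : ∀ k, Measurable fun q : (Λ × Λ) × Λ => (q.2, bobOutcome k q.1) := fun k =>
    measurable_snd.prodMk ((measurable_bobOutcome k).comp measurable_fst)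
  have hJ : ∀ i k, IsJointDistribution ρ (M₁ i) (M₂ k)
      ((μ i).map fun q => (q.2, bobOutcome k q.1)) := by
    intro i k
    refine ⟨Measure.isProbabilityMeasure_map (hmeas k).aemeasurable, fun D E hD hE => ?_⟩
    rw [measureReal_def, Measure.map_apply (hmeas k) (hD.prod hE), ← measureReal_def]
    fin_cases k
    · have hpre : (fun q : (Λ × Λ) × Λ => (q.2, bobOutcome 0 q.1)) ⁻¹' (D ×ˢ E) =
          (E ×ˢ Set.univ) ×ˢ D := by
        ext q
        simp [bobOutcome, and_comm]
      have h := hμ i D E Set.univ hD hE .univ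
      rw [POVM.effect_univ, h3] at h
      exact h.trans (by rw [← hpre]; rfl)
    · have hpre : (fun q : (Λ × Λ) × Λ => (q.2, bobOutcome 1 q.1)) ⁻¹' (D ×ˢ E) =
          (Set.univ ×ˢ E) ×ˢ D := by
        ext q
        simp [bobOutcome, and_comm]
      have h := hμ i D Set.univ E hD .univ hE
      rw [POVM.effect_univ, h2] at h
      exact h.trans (by rw [← hpre]; rfl)
  have hPμ : ∀ i k, P i k = (μ i).map fun q => (q.2, bobOutcome k q.1) := fun i k => by
    rw [hP, (hJ i k).jointDistribution_eq]
  have hJP : ∀ i k, IsJointDistribution ρ (M₁ i) (M₂ k) (P i k) := fun i k => by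
    rw [hPμ]
    exact hJ i k
  have hcorr : ∀ i k, ((correlation (P i k) : ℝ) : ℂ) = trace (ρ ∘L opTensor (A i) (B k)) := by
    intro i k
    have := (hJP i k).1
    rw [hA, hB]
    exact (hNρ.trace_opTensor_integral (M₁ i) (M₂ k) (P i k) (hJP i k).2 measurable_subtype_coe
      measurable_subtype_coe hbd hbd).symm
  have hcorr' : ∀ i k, (trace (ρ ∘L opTensor (A i) (B k))).re = correlation (P i k) := fun i k => by
    rw [← hcorr, Complex.ofReal_re]
  have hcorrμ : ∀ i k, correlation (P i k) =
      ∫ q, (q.2 : ℝ) * (bobOutcome k q.1 : ℝ) ∂(μ i) := by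
    intro i k
    have hm : Measurable fun p : Λ × Λ => (p.1 : ℝ) * (p.2 : ℝ) := by fun_prop
    rw [correlation, hPμ, integral_map (hmeas k).aemeasurable hm.aestronglyMeasurable]
  -- Needed for both settings: `μ 0` enters the Bell inequality, `μ 1` the conditional integral.
  have hσ : ∀ i, (trace (partialTrace₁ R ∘L opTensor (B 0) (B 1))).re =
      ∫ q, (q.1.1 : ℝ) * (q.1.2 : ℝ) ∂(μ i) := by
    intro i
    have hm : Measurable fun p : Λ × Λ => (p.1 : ℝ) * (p.2 : ℝ) := by fun_prop
    have h := hNσ.trace_opTensor_integral (M₂ 0) (M₂ 1) (μ i).fst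
      (fun E F hE hF => (hN.trace_partialTrace₁ _).trans (hνreal i E F hE hF))
      measurable_subtype_coe measurable_subtype_coe hbd hbd
    rw [Measure.fst, integral_map measurable_fst.aemeasurable hm.aestronglyMeasurable] at h
    rw [hB, hB]
    exact (congrArg Complex.re h).trans (Complex.ofReal_re _)
  have hrep : (LHVModel.ofMeasures ν μ).Reproduces P := fun i k => by
    rw [hPμ, LHVModel.ofMeasures_bind hfst]
  have hint : ∀ i (f : (Λ × Λ) × Λ → ℝ), Measurable f → (∀ q, |f q| ≤ 1) →
      Integrable f (μ i) := fun i f hf hb =>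
    Integrable.of_bound hf.aestronglyMeasurable 1 (Filter.Eventually.of_forall hb)
  have i1 : ∀ i, Integrable (fun q : (Λ × Λ) × Λ => (q.1.1 : ℝ) * (q.1.2 : ℝ)) (μ i) := fun i =>
    hint i _ (by fun_prop) fun q => hbd2 _ _
  have i2 : ∀ i, Integrable (fun q : (Λ × Λ) × Λ => (q.2 : ℝ) * (q.1.1 : ℝ)) (μ i) := fun i =>
    hint i _ (by fun_prop) fun q => hbd2 _ _
  have i3 : ∀ i, Integrable (fun q : (Λ × Λ) × Λ => (q.2 : ℝ) * (q.1.2 : ℝ)) (μ i) := fun i =>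
    hint i _ (by fun_prop) fun q => hbd2 _ _
  refine ⟨fun i k => ⟨hJP i k, hcorr i k⟩, ⟨_, hrep⟩, fun s _ hcond => ?_⟩
  have hbell : |correlation (P 0 0) - correlation (P 0 1)| ≤ 1 - s * correlation (P 1 1) := by
    have hle : |correlation (P 0 0) - correlation (P 0 1)| ≤
        1 - ∫ q, (q.1.1 : ℝ) * (q.1.2 : ℝ) ∂(μ 0) := by
      have e1 : correlation (P 0 0) - correlation (P 0 1) =
          ∫ q, ((q.2 : ℝ) * (q.1.1 : ℝ) - (q.2 : ℝ) * (q.1.2 : ℝ)) ∂(μ 0) := by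
        rw [integral_sub (i2 0) (i3 0), hcorrμ, hcorrμ]
        rfl
      have e2 : 1 - ∫ q, (q.1.1 : ℝ) * (q.1.2 : ℝ) ∂(μ 0) =
          ∫ q, (1 - (q.1.1 : ℝ) * (q.1.2 : ℝ)) ∂(μ 0) := by
        rw [integral_sub (integrable_const _) (i1 0)]
        simp
      rw [e1, e2]
      refine (abs_integral_le_integral_abs).trans
        (integral_mono ((i2 0).sub (i3 0)).abs ((integrable_const _).sub (i1 0)) fun q => ?_)
      change |(q.2 : ℝ) * (q.1.1 : ℝ) - (q.2 : ℝ) * (q.1.2 : ℝ)| ≤ 1 - (q.1.1 : ℝ) * (q.1.2 : ℝ)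
      rw [← mul_sub, abs_mul]
      exact (mul_le_of_le_one_left (abs_nonneg _) (hbd _)).trans
        (abs_sub_le_one_sub_mul (hbd _) (hbd _))
    -- The sign assumption bounds the mean product of Bob's outcomes below by `s * correlation (P 1
    -- 1)`.
    rw [hσ 0, hcorr'] at hcond
    linarith
  refine ⟨⟨_, hrep, ?_⟩, hbell, ?_⟩
  · have hm : Measurable fun p : Λ × Λ × Λ => (p.2.2 : ℝ) * ((p.2.1 : ℝ) - s * (p.1 : ℝ)) := by
      fun_prop
    rw [LHVModel.IsConditional, LHVModel.ofMeasures_tripleDistribution hfst,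
      integral_map measurable_swap.aemeasurable hm.aestronglyMeasurable]
    -- Once expanded, the integrand has as its mean under `μ 1` exactly the left side of the sign
    -- assumption.
    have e : ∀ q : (Λ × Λ) × Λ, (q.swap.2.2 : ℝ) * ((q.swap.2.1 : ℝ) - s * (q.swap.1 : ℝ)) =
        (q.1.1 : ℝ) * (q.1.2 : ℝ) - s * ((q.2 : ℝ) * (q.1.2 : ℝ)) := fun q => by
      simp only [Prod.fst_swap, Prod.snd_swap]
      ring
    simp only [e]
    rw [integral_sub (i1 1) ((i3 1).const_mul s), integral_const_mul]
    rw [hσ 1, hcorr', hcorrμ] at hcond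
    exact hcond
  · rw [hcorr', hcorr', hcorr']
    exact hbell
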